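/- Let $K\ge 1$, $d_1,\dots,d_K\ge 1$, $R\ge 1$ be integers and let $\alpha,\sigma>0$. Let $f$ be one of the following link functions with scale $\sigma$: the logistic link $f(\theta)=(1+e^{-\theta/\sigma})^{-1}$; the probit link $f(\theta)=\Phi(\theta/\sigma)$, where $\Phi$ is the standard Gaussian distribution function; or the Laplacian link $f(\theta)=\frac12 e^{\theta/\sigma}$ for $\theta<0$ and $f(\theta)=1-\frac12 e^{-\theta/\sigma}$ for $\theta\ge 0$. The CP rank of a tensor $\Theta\in\mathbb{R}^{d_1\times\cdots\times d_K}$ is the least $r$ for which $\Theta=\sum_{s=1}^{r}\lambda_s\, a^{(1)}_s\otimes\cdots\otimes a^{(K)}_s$ with $\lambda_1\ge\cdots\ge\lambda_r>0$ and Euclidean unit vectors $a^{(k)}_s\in\mathbb{R}^{d_k}$. Let $\mathcal{D}$ be a compact set of tensors in $\mathbb{R}^{d_1\times\cdots\times d_K}$, each of which has CP rank exactly $R$ and all entries bounded by $\alpha$ in absolute value, and let $\Theta_{\rm true}\in\mathcal{D}$. Let $\mathcal{Y}\in\{0,1\}^{d_1\times\cdots\times d_K}$ be a random tensor with mutually independent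 entries and $\mathbb{P}(\mathcal{Y}_{i}=1)=f(\Theta_{{\rm true},i})$ for every index $i=(i_1,\dots,i_K)$. Let $\hat\Theta_{\rm MLE}=\hat\Theta_{\rm MLE}(\mathcal{Y})$ be any maximizer over $\Theta\in\mathcal{D}$ of the log-likelihood $$\mathcal{L}_{\mathcal{Y}}(\Theta)=\sum_{i}\bigl[\mathbf{1}_{\{\mathcal{Y}_i=1\}}\log f(\Theta_i)+\mathbf{1}_{\{\mathcal{Y}_i=0\}}\log(1-f(\Theta_i))\bigr],$$ and put $\mathrm{Loss}(\hat\Theta,\Theta_{\rm true})=\bigl(\prod_k d_k\bigr)^{-1/2}\|\hat\Theta-\Theta_{\rm true}\|_F$, where $\|\cdot\|_F$ is the Frobenius norm. There exist an absolute constant $C'>0$ and constants $C_1,C_2,C_3>0$ that depend only on $K$ such that, with probability at least $1-\exp\bigl(-C'\log K\,\sum_k d_k\bigr)$, $$\mathrm{Loss}(\hat\Theta_{\rm MLE},\Theta_{\rm true})\le\min\left\{2\alpha,\ C(\alpha,\sigma)\sqrt{\frac{R^{K-1}\sum_k d_k}{\prod_k d_k}}\right\},$$ where $$C(\alpha,\sigma)=\begin{cases}C_1\,\sigma\left(2+e^{\alpha/\sigma}+e^{-\alpha/\sigma}\right)&\text{for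 the logistic link},\\[2pt] C_2\,\sigma\left(\dfrac{\alpha+\sigma}{6\alpha+\sigma}\right)e^{\alpha^2/\sigma^2}&\text{for the probit link},\\[2pt] C_3\,\sigma\,e^{\alpha/\sigma}&\text{for the Laplacian link}.\end{cases}$$ -/

import Mathlib

open MeasureTheory ProbabilityTheory

noncomputable section

namespace BinaryTensor

/-- The index set `[d₁] × ⋯ × [d_K]` of an order-`K` tensor of dimension `(d₁, …, d_K)`. -/
abbrev Idx {K : ℕ} (d : Fin K → ℕ) : Type := (k : Fin K) → Fin (d k)

/-- Real tensors in `ℝ^{d₁ × ⋯ × d_K}`. -/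
abbrev RealTensor {K : ℕ} (d : Fin K → ℕ) : Type := Idx d → ℝ

/-- Binary tensors in `{0,1}^{d₁ × ⋯ × d_K}`, with `true` for `1` and `false` for `0`. -/
abbrev BinTensor {K : ℕ} (d : Fin K → ℕ) : Type := Idx d → Bool

/-- `Θ = ∑_{r ≤ R} w_r a_r^{(1)} ⊗ ⋯ ⊗ a_r^{(K)}` with `w₁ ≥ ⋯ ≥ w_R > 0` and Euclidean unit
vectors `a_r^{(k)} ∈ S^{d_k - 1}`. -/
def HasCPDecomposition {K : ℕ} {d : Fin K → ℕ} (Θ : RealTensor d) (R : ℕ) : Prop :=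
  ∃ (w : Fin R → ℝ) (a : Fin R → (k : Fin K) → EuclideanSpace ℝ (Fin (d k))),
    Antitone w ∧ (∀ r, 0 < w r) ∧ (∀ r k, ‖a r k‖ = 1) ∧
      ∀ i : Idx d, Θ i = ∑ r, w r * ∏ k, a r k (i k)

/-- `rank(Θ) = R`: the least number of terms in a CP decomposition of `Θ` is `R`. -/
def HasCPRank {K : ℕ} {d : Fin K → ℕ} (Θ : RealTensor d) (R : ℕ) : Prop :=
  IsLeast {r : ℕ | HasCPDecomposition Θ r} R

/-- The set of tensors of CP rank `R` all of whose entries are at most `α` in absolute value. -/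
def signalSet {K : ℕ} (d : Fin K → ℕ) (R : ℕ) (α : ℝ) : Set (RealTensor d) :=
  {Θ | HasCPRank Θ R ∧ ∀ i, |Θ i| ≤ α}

/-- The three link functions, each with a scale parameter `σ`. -/
inductive Link : Type
  | logistic
  | probit
  | laplacian

/-- The link function `f = f_σ : ℝ → [0,1]`. For the probit link, the value is `Φ(θ / σ)` with `Φ`
the distribution function of the standard Gaussian law. -/
def Link.fn : Link → ℝ → ℝ → ℝ
  | .logistic, σ, θ => (1 + Real.exp (-θ / σ))⁻¹
  | .probit, σ, θ => cdf (gaussianReal 0 1) (θ / σ)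
  | .laplacian, σ, θ =>
      if θ < 0 then (1 / 2) * Real.exp (θ / σ) else 1 - (1 / 2) * Real.exp (-θ / σ)

/-- The factor `C(α, σ)` of the error bound, with constants `C₁, C₂, C₃`. -/
def Link.scaleFactor (C₁ C₂ C₃ : ℝ) : Link → ℝ → ℝ → ℝ
  | .logistic, α, σ => C₁ * σ * (2 + Real.exp (α / σ) + Real.exp (-α / σ))
  | .probit, α, σ => C₂ * σ * ((α + σ) / (6 * α + σ)) * Real.exp (α ^ 2 / σ ^ 2)
  | .laplacian, α, σ => C₃ * σ * Real.exp (α / σ)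

/-- The random binary tensor `Y` has mutually independent entries with
`P(Y_i = 1) = f(Θ_i)` for all `i`. -/
structure FollowsBernoulliModel {K : ℕ} {d : Fin K → ℕ} {Ω : Type*} [MeasurableSpace Ω]
    (μ : Measure Ω) (f : ℝ → ℝ) (Θ : RealTensor d) (Y : Ω → BinTensor d) : Prop where
  measurable : ∀ i, Measurable fun ω => Y ω i
  indep : iIndepFun (fun i ω => Y ω i) μ
  prob_one : ∀ i, μ.real {ω | Y ω i = true} = f (Θ i)

/-- The log-likelihood `L_y(Θ) = ∑_i [1_{y_i = 1} log f(Θ_i) + 1_{y_i = 0} log (1 - f(Θ_i))]`. -/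
def logLikelihood {K : ℕ} {d : Fin K → ℕ} (f : ℝ → ℝ) (y : BinTensor d) (Θ : RealTensor d) : ℝ :=
  ∑ i, if y i = true then Real.log (f (Θ i)) else Real.log (1 - f (Θ i))

/-- `Θhat` is a maximizer over `D` of the log-likelihood at the data `y`. -/
def IsConstrainedMLE {K : ℕ} {d : Fin K → ℕ} (f : ℝ → ℝ) (D : Set (RealTensor d))
    (y : BinTensor d) (Θhat : RealTensor d) : Prop :=
  Θhat ∈ D ∧ IsMaxOn (logLikelihood f y) D Θhat

/-- The Frobenius norm. -/
def frobeniusNorm {K : ℕ} {d : Fin K → ℕ} (A : RealTensor d) : ℝ :=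
  Real.sqrt (∑ i, A i ^ 2)

/-- `Loss(Θ₁, Θ₂) = ‖Θ₁ - Θ₂‖_F / √(∏_k d_k)`. -/
def loss {K : ℕ} {d : Fin K → ℕ} (Θ₁ Θ₂ : RealTensor d) : ℝ :=
  (1 / Real.sqrt (∏ k, (d k : ℝ))) * frobeniusNorm (Θ₁ - Θ₂)

end BinaryTensor

end

/-!
The log-likelihood of a Bernoulli model splits, in the log-odds, into a linear noise term minus a
Kullback-Leibler divergence. On a range where the variance `f (1 - f)` is at least `m` and the
log-odds are bi-Lipschitz with constants `l` and `L`, the divergence is at least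
`(m l² / 2) ‖Θ' - Θ‖²`, so that for an estimator at least as likely as the truth this quantity is
at most the noise term at the estimator. What has to be controlled is therefore the supremum over
all possible estimates of the noise penalized by a multiple of the squared distance. Symmetrization
and contraction, applied one coordinate at a time inside a convex function, replace the noise by the
linear process `⟨ε, Θ' - Θ⟩` with Rademacher signs `ε`. A tensor `T` of rank at most `R` satisfies
`⟨ε, T⟩ ≤ R^((K-1)/2) ‖ε‖ ‖T‖`, where `‖ε‖` is the spectral norm, and completing the square in `‖T‖`
leaves the exponential of a small multiple of `‖ε‖²`. Its mean is at most `√2` times the size of a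
net of product vectors, because `⟨ε, z⟩` is sub-Gaussian for each `z` in the net. Markov's
inequality finishes the argument: the net has at most `5 ^ ∑ d` elements, which costs `3 ∑ d` in the
exponent.
-/

noncomputable section

namespace BinaryTensor

section Convexity

theorem add_le_add_of_weaklyMajorized {φ : ℝ → ℝ} (hφ : ConvexOn ℝ Set.univ φ)
    (hmono : Monotone φ) {a b a' b' : ℝ} (ha : a ≤ max a' b') (hb : b ≤ max a' b')
    (hab : a + b ≤ a' + b') : φ a + φ b ≤ φ a' + φ b' := by
  wlog h : b' ≤ a' generalizing a' b'
  · rw [add_comm (φ a')]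
    exact this (by rwa [max_comm]) (by rwa [max_comm]) (by rwa [add_comm b'])
      (le_of_not_ge h)
  rw [max_eq_left h] at ha hb
  rcases le_or_gt b b' with hb' | hb'
  · exact add_le_add (hmono ha) (hmono hb')
  set s := (b - b') / (a' - b')
  have hpos : 0 < a' - b' := by linarith
  have hs0 : 0 ≤ s := div_nonneg (by linarith) hpos.le
  have hs1 : 0 ≤ 1 - s := sub_nonneg.2 ((div_le_one hpos).2 (by linarith))
  have hs : s * (a' - b') = b - b' := div_mul_cancel₀ _ hpos.ne'
  have hb_le : φ b ≤ s * φ a' + (1 - s) * φ b' := by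
    have := hφ.2 (Set.mem_univ a') (Set.mem_univ b') hs0 hs1 (by ring)
    rwa [smul_eq_mul, smul_eq_mul, show s * a' + (1 - s) * b' = b by linarith] at this
  have ha_le : φ a ≤ (1 - s) * φ a' + s * φ b' := by
    have := hφ.2 (Set.mem_univ a') (Set.mem_univ b') hs1 hs0 (by ring)
    exact (hmono (by rw [smul_eq_mul, smul_eq_mul]; linarith)).trans this
  linarith

theorem convexOn_comp_iSup {τ : Type*} [Finite τ] [Nonempty τ] {φ : ℝ → ℝ}
    (hφ : ConvexOn ℝ Set.univ φ) (hmono : Monotone φ) :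
    ConvexOn ℝ Set.univ fun v : τ → ℝ => φ (⨆ t, v t) :=
  ⟨convex_univ, fun v _ w _ _ _ ha hb hab =>
    (hmono (ciSup_le fun t => add_le_add (mul_le_mul_of_nonneg_left (Finite.le_ciSup v t) ha)
      (mul_le_mul_of_nonneg_left (Finite.le_ciSup w t) hb))).trans
        (hφ.2 trivial trivial ha hb hab)⟩

theorem two_point_contraction {τ : Type*} [Finite τ] [Nonempty τ] {φ : ℝ → ℝ}
    (hφ : ConvexOn ℝ Set.univ φ) (hmono : Monotone φ) (u : τ → ℝ) {a b : τ → ℝ}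
    (hab : ∀ t s, |a t - a s| ≤ |b t - b s|) (h0 : ∀ t, |a t| ≤ |b t|) :
    φ (⨆ t, (u + a) t) + φ (⨆ t, (u - a) t) ≤ φ (⨆ t, (u + b) t) + φ (⨆ t, (u - b) t) := by
  obtain ⟨t, ht⟩ := exists_eq_ciSup_of_finite (f := u + a)
  obtain ⟨s, hs⟩ := exists_eq_ciSup_of_finite (f := u - a)
  rw [← ht, ← hs]
  have hplus := Finite.le_ciSup (u + b)
  have hminus := Finite.le_ciSup (u - b)
  simp only [Pi.add_apply, Pi.sub_apply] at hplus hminus ⊢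
  have hmax : ∀ t, u t + |b t| ≤ max (⨆ t, (u t + b t)) (⨆ t, (u t - b t)) := by
    intro t
    rcases abs_choice (b t) with h | h
    · exact le_max_of_le_left (by rw [h]; exact hplus t)
    · exact le_max_of_le_right (by rw [h, ← sub_eq_add_neg]; exact hminus t)
  refine add_le_add_of_weaklyMajorized hφ hmono ?_ ?_ ?_
  · linarith [hmax t, h0 t, le_abs_self (a t)]
  · linarith [hmax s, h0 s, neg_abs_le (a s)]
  · have hts := (le_abs_self _).trans (hab t s)
    rcases abs_choice (b t - b s) with h | h
    · linarith [hplus t, hminus s]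
    · linarith [hplus s, hminus t]

theorem two_point_symmetrization {E : Type*} [AddCommGroup E] [Module ℝ E] {F : E → ℝ}
    (hF : ConvexOn ℝ Set.univ F) {p : ℝ} (hp : p ∈ Set.Icc 0 1) (u a : E) :
    p * F (u + (1 - p) • a) + (1 - p) * F (u + (0 - p) • a) ≤
      1 / 2 * (F (u + a) + F (u - a)) := by
  have hconv : ∀ s ∈ Set.Icc (-1 : ℝ) 1,
      F (u + s • a) ≤ (1 + s) / 2 * F (u + a) + (1 - s) / 2 * F (u - a) := by
    rintro s ⟨hs, hs'⟩
    have := hF.2 (Set.mem_univ (u + a)) (Set.mem_univ (u - a))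
      (show 0 ≤ (1 + s) / 2 by linarith) (show 0 ≤ (1 - s) / 2 by linarith) (by ring)
    rwa [show ((1 + s) / 2) • (u + a) + ((1 - s) / 2) • (u - a) = u + s • a by module] at this
  obtain ⟨hp0, hp1⟩ := hp
  have h1 := mul_le_mul_of_nonneg_left (hconv (1 - p) ⟨by linarith, by linarith⟩) hp0
  have h2 := mul_le_mul_of_nonneg_left (hconv (0 - p) ⟨by linarith, by linarith⟩)
    (sub_nonneg.2 hp1)
  linarith

end Convexity

section BernoulliMean

variable {ι κ : Type*} [Fintype ι] [DecidableEq ι]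

/-- The probability of `y` under the product of the Bernoulli laws with parameters `p i`. -/
def bernoulliWeight {ι : Type*} [Fintype ι] (p : ι → ℝ) (y : ι → Bool) : ℝ :=
  ∏ i, if y i then p i else 1 - p i

/-- The expectation of `F` under the product of the Bernoulli laws with parameters `p i`, written as
a finite sum so that no measurability or integrability question arises. -/
def bernoulliMean (p : ι → ℝ) (F : (ι → Bool) → ℝ) : ℝ :=
  ∑ y, bernoulliWeight p y * F y

/-- The expectation of `F` at a vector of independent uniform signs. -/
def rademacherMean (F : (ι → ℝ) → ℝ) : ℝ :=
  bernoulliMean (fun _ => 1 / 2) fun y => F fun i => if y i then 1 else -1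

theorem bernoulliWeight_nonneg {ι : Type*} [Fintype ι] {p : ι → ℝ} (hp : ∀ i, p i ∈ Set.Icc 0 1)
    (y : ι → Bool) : 0 ≤ bernoulliWeight p y :=
  Finset.prod_nonneg fun i _ => by
    split_ifs
    exacts [(hp i).1, sub_nonneg.2 (hp i).2]

theorem bernoulliMean_mono {p : ι → ℝ} (hp : ∀ i, p i ∈ Set.Icc 0 1) {F G : (ι → Bool) → ℝ}
    (h : ∀ y, F y ≤ G y) : bernoulliMean p F ≤ bernoulliMean p G :=
  Finset.sum_le_sum fun y _ => mul_le_mul_of_nonneg_left (h y) (bernoulliWeight_nonneg hp y)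

theorem bernoulliMean_const_mul (p : ι → ℝ) (c : ℝ) (F : (ι → Bool) → ℝ) :
    bernoulliMean p (fun y => c * F y) = c * bernoulliMean p F := by
  simp only [bernoulliMean, Finset.mul_sum, mul_left_comm]

theorem bernoulliMean_add (p : ι → ℝ) (F G : (ι → Bool) → ℝ) :
    bernoulliMean p (fun y => F y + G y) = bernoulliMean p F + bernoulliMean p G := by
  simp only [bernoulliMean, mul_add, Finset.sum_add_distrib]

theorem rademacherMean_mono {F G : (ι → ℝ) → ℝ} (h : ∀ ε, F ε ≤ G ε) :
    rademacherMean F ≤ rademacherMean G :=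
  bernoulliMean_mono (fun _ => by norm_num) fun _ => h _

theorem rademacherMean_sum (s : Finset κ) (F : κ → (ι → ℝ) → ℝ) :
    rademacherMean (fun ε => ∑ z ∈ s, F z ε) = ∑ z ∈ s, rademacherMean (F z) := by
  simp only [rademacherMean, bernoulliMean, Finset.mul_sum]
  exact Finset.sum_comm

theorem bernoulliMean_prod (p : ι → ℝ) (g : ι → Bool → ℝ) :
    bernoulliMean p (fun y => ∏ i, g i (y i)) =
      ∏ i, (p i * g i true + (1 - p i) * g i false) := by
  have hsum : ∀ i, p i * g i true + (1 - p i) * g i false =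
      ∑ b, (if b then p i else 1 - p i) * g i b := fun i => by simp
  simp only [bernoulliMean, bernoulliWeight, hsum, Finset.prod_univ_sum, Fintype.piFinset_univ,
    Finset.prod_mul_distrib]

theorem bernoulliMean_comp_equiv [Fintype κ] [DecidableEq κ] (e : κ ≃ ι) (p : ι → ℝ)
    (F : (ι → Bool) → ℝ) :
    bernoulliMean p F = bernoulliMean (p ∘ e) fun y => F (y ∘ e.symm) := by
  unfold bernoulliMean bernoulliWeight
  rw [← (Equiv.arrowCongr e (Equiv.refl Bool)).sum_comp]
  refine Finset.sum_congr rfl fun y _ => ?_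
  rw [← e.prod_comp]
  simp only [Equiv.arrowCongr_apply, Equiv.coe_refl, Function.comp_apply, id_eq,
    Equiv.symm_apply_apply]
  rfl

theorem bernoulliMean_fin_succ {n : ℕ} (p : Fin (n + 1) → ℝ) (F : (Fin (n + 1) → Bool) → ℝ) :
    bernoulliMean p F =
      p 0 * bernoulliMean (Fin.tail p) (fun y => F (Fin.cons true y)) +
        (1 - p 0) * bernoulliMean (Fin.tail p) (fun y => F (Fin.cons false y)) := by
  unfold bernoulliMean bernoulliWeight
  rw [← (Fin.consEquiv fun _ => Bool).sum_comp, Fintype.sum_prod_type, Fintype.sum_bool]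
  simp [Fin.consEquiv, Fin.prod_univ_succ, Fin.tail, Finset.mul_sum, mul_assoc]

private theorem bernoulliMean_le_of_coordinatewise_fin {E : Type*} [AddCommMonoid E] {n : ℕ}
    {p q : Fin n → ℝ} (hp : ∀ i, p i ∈ Set.Icc 0 1) (hq : ∀ i, q i ∈ Set.Icc 0 1)
    (g h : Fin n → Bool → E) (F : E → ℝ)
    (hF : ∀ i u, p i * F (u + g i true) + (1 - p i) * F (u + g i false) ≤
      q i * F (u + h i true) + (1 - q i) * F (u + h i false)) :
    bernoulliMean p (fun y => F (∑ i, g i (y i))) ≤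
      bernoulliMean q (fun y => F (∑ i, h i (y i))) := by
  induction n generalizing F with
  | zero => simp [bernoulliMean, bernoulliWeight]
  | succ n ih =>
    have hih : ∀ v, bernoulliMean (Fin.tail p) (fun y => F (v + ∑ i, Fin.tail g i (y i))) ≤
        bernoulliMean (Fin.tail q) (fun y => F (v + ∑ i, Fin.tail h i (y i))) := fun v =>
      ih (fun i => hp i.succ) (fun i => hq i.succ) _ _ (fun w => F (v + w))
        fun i u => by simpa only [add_assoc, Fin.tail] using hF i.succ (v + u)
    simp only [bernoulliMean_fin_succ, Fin.sum_univ_succ, Fin.cons_zero, Fin.cons_succ]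
    refine (add_le_add (mul_le_mul_of_nonneg_left (hih _) (hp 0).1)
      (mul_le_mul_of_nonneg_left (hih _) (sub_nonneg.2 (hp 0).2))).trans ?_
    simp only [← bernoulliMean_const_mul, ← bernoulliMean_add]
    refine bernoulliMean_mono (fun _ => hq _) fun y => ?_
    simpa only [add_comm, Fin.tail] using hF 0 (∑ i, h i.succ (y i))

theorem bernoulliMean_le_of_coordinatewise {E : Type*} [AddCommMonoid E]
    {p q : ι → ℝ} (hp : ∀ i, p i ∈ Set.Icc 0 1) (hq : ∀ i, q i ∈ Set.Icc 0 1)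
    (g h : ι → Bool → E) (F : E → ℝ)
    (hF : ∀ i u, p i * F (u + g i true) + (1 - p i) * F (u + g i false) ≤
      q i * F (u + h i true) + (1 - q i) * F (u + h i false)) :
    bernoulliMean p (fun y => F (∑ i, g i (y i))) ≤
      bernoulliMean q (fun y => F (∑ i, h i (y i))) := by
  let e := (Fintype.equivFin ι).symm
  rw [bernoulliMean_comp_equiv e, bernoulliMean_comp_equiv e q]
  simp only [← e.sum_comp, Function.comp_apply, Equiv.symm_apply_apply]
  exact bernoulliMean_le_of_coordinatewise_fin (fun i => hp (e i)) (fun i => hq (e i))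
    (fun i => g (e i)) (fun i => h (e i)) F fun i => hF (e i)

theorem bernoulliMean_iSup_le_rademacherMean_iSup {τ : Type*} [Finite τ] [Nonempty τ]
    {φ : ℝ → ℝ} (hφ : ConvexOn ℝ Set.univ φ) (hmono : Monotone φ) {p : ι → ℝ}
    (hp : ∀ i, p i ∈ Set.Icc 0 1) (u : τ → ℝ) (a b : ι → τ → ℝ)
    (hab : ∀ i t s, |a i t - a i s| ≤ |b i t - b i s|) (h0 : ∀ i t, |a i t| ≤ |b i t|) :
    bernoulliMean p (fun y => φ (⨆ t, (u t + ∑ i, ((if y i then 1 else 0) - p i) * a i t))) ≤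
      rademacherMean (fun ε => φ (⨆ t, (u t + ∑ i, ε i * b i t))) := by
  have hcompare := bernoulliMean_le_of_coordinatewise (q := fun _ => 1 / 2) hp
    (fun _ => by norm_num) (fun i c => ((if c then 1 else 0) - p i) • a i)
    (fun i c => (if c then (1 : ℝ) else -1) • b i) (fun v => φ (⨆ t, (u + v) t)) fun i v => by
      have hsymm := two_point_symmetrization (convexOn_comp_iSup hφ hmono) (hp i) (u + v) (a i)
      have hcontr := two_point_contraction hφ hmono (u + v) (hab i) (h0 i)
      simp only [if_true, Bool.false_eq_true, if_false, one_smul, neg_one_smul, ← add_assoc,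
        ← sub_eq_add_neg, ← add_sub_assoc]
      linarith
  simpa only [rademacherMean, Pi.add_apply, Finset.sum_apply, Pi.smul_apply, smul_eq_mul]
    using hcompare

end BernoulliMean

section SubGaussian

variable {ι : Type*} [Fintype ι] [DecidableEq ι]

theorem rademacherMean_exp_le {c : ι → ℝ} (hc : ∑ i, c i ^ 2 ≤ 1) (t : ℝ) :
    rademacherMean (fun ε => Real.exp (t * ∑ i, ε i * c i)) ≤ Real.exp (t ^ 2 / 2) := by
  calc rademacherMean (fun ε => Real.exp (t * ∑ i, ε i * c i))
      = ∏ i, Real.cosh (t * c i) := by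
        simp only [rademacherMean, Finset.mul_sum, Real.exp_sum]
        rw [bernoulliMean_prod _ fun i b => Real.exp (t * ((if b then 1 else -1) * c i))]
        refine Finset.prod_congr rfl fun i _ => ?_
        rw [Real.cosh_eq]
        simp only [if_true, Bool.false_eq_true, if_false]
        ring_nf
    _ ≤ ∏ i, Real.exp ((t * c i) ^ 2 / 2) :=
        Finset.prod_le_prod (fun i _ => (Real.cosh_pos _).le)
          fun i _ => Real.cosh_le_exp_half_sq _
    _ = Real.exp (t ^ 2 / 2 * ∑ i, c i ^ 2) := by
        rw [← Real.exp_sum, Finset.mul_sum]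
        exact congrArg _ (Finset.sum_congr rfl fun i _ => by ring)
    _ ≤ Real.exp (t ^ 2 / 2) := Real.exp_le_exp.2 (mul_le_of_le_one_right (by positivity) hc)

theorem integrable_bernoulliMean {X : Type*} [MeasurableSpace X] {μ : Measure X} (p : ι → ℝ)
    {F : (ι → Bool) → X → ℝ} (hF : ∀ y, Integrable (F y) μ) :
    Integrable (fun x => bernoulliMean p fun y => F y x) μ :=
  integrable_finsetSum _ fun y _ => (hF y).const_mul _

theorem bernoulliMean_integral {X : Type*} [MeasurableSpace X] {μ : Measure X} (p : ι → ℝ)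
    {F : (ι → Bool) → X → ℝ} (hF : ∀ y, Integrable (F y) μ) :
    bernoulliMean p (fun y => ∫ x, F y x ∂μ) = ∫ x, bernoulliMean p (fun y => F y x) ∂μ := by
  simp only [bernoulliMean, ← integral_const_mul]
  exact (integral_finsetSum _ fun y _ => (hF y).const_mul _).symm

theorem gaussianPDFReal_smul_exp_sq_div_four (x : ℝ) :
    gaussianPDFReal 0 1 x • Real.exp (x ^ 2 / 4) =
      (√(2 * Real.pi))⁻¹ * Real.exp (-(1 / 4) * x ^ 2) := by
  rw [gaussianPDFReal, smul_eq_mul, mul_assoc, ← Real.exp_add]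
  simp only [NNReal.coe_one, mul_one, sub_zero]
  ring_nf

theorem integrable_exp_sq_div_four_gaussianReal :
    Integrable (fun x : ℝ => Real.exp (x ^ 2 / 4)) (gaussianReal 0 1) := by
  rw [gaussianReal_of_var_ne_zero _ one_ne_zero,
    integrable_withDensity_iff_integrable_smul' (measurable_gaussianPDF _ _)
      (.of_forall fun x => gaussianPDF_lt_top)]
  simp only [toReal_gaussianPDF, gaussianPDFReal_smul_exp_sq_div_four]
  exact (integrable_exp_neg_mul_sq (by norm_num)).const_mul _

theorem integral_exp_sq_div_four_gaussianReal :
    ∫ x, Real.exp (x ^ 2 / 4) ∂gaussianReal 0 1 = √2 := by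
  simp only [integral_gaussianReal_eq_integral_smul one_ne_zero,
    gaussianPDFReal_smul_exp_sq_div_four]
  rw [integral_const_mul, integral_gaussian, ← Real.sqrt_inv, ← Real.sqrt_mul (by positivity)]
  congr 1
  field_simp
  norm_num

theorem integral_exp_mul_gaussianReal (z : ℝ) :
    ∫ x, Real.exp (z * x) ∂gaussianReal 0 1 = Real.exp (z ^ 2 / 2) := by
  simpa [mgf] using congrFun (mgf_id_gaussianReal (μ := 0) (v := 1)) z

-- `exp (z² / 4)` is the mean of `exp (z g / √2)` over a standard Gaussian `g`, which reduces the
-- square-exponential moment to the exponential moments bounded above.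
theorem rademacherMean_exp_sq_le {c : ι → ℝ} (hc : ∑ i, c i ^ 2 ≤ 1) :
    rademacherMean (fun ε => Real.exp ((∑ i, ε i * c i) ^ 2 / 4)) ≤ √2 := by
  have hcomm (z : ℝ) : (fun x => Real.exp (x / √2 * z)) = fun x => Real.exp (z / √2 * x) :=
    funext fun x => by rw [div_mul_comm]
  have h_integrable (z : ℝ) : Integrable (fun x => Real.exp (x / √2 * z)) (gaussianReal 0 1) :=
    hcomm z ▸ integrable_exp_mul_gaussianReal _
  have hlinearize (z : ℝ) :
      Real.exp (z ^ 2 / 4) = ∫ x, Real.exp (x / √2 * z) ∂gaussianReal 0 1 := by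
    rw [hcomm, integral_exp_mul_gaussianReal, div_pow, Real.sq_sqrt zero_le_two, div_div]
    norm_num
  simp only [rademacherMean, hlinearize]
  rw [bernoulliMean_integral _ fun y => h_integrable _]
  refine (integral_mono (integrable_bernoulliMean _ fun y => h_integrable _)
    integrable_exp_sq_div_four_gaussianReal fun x =>
      (rademacherMean_exp_le hc (x / √2)).trans_eq ?_).trans_eq
        integral_exp_sq_div_four_gaussianReal
  rw [div_pow, Real.sq_sqrt zero_le_two, div_div]
  norm_num

end SubGaussian

section Net

variable {E : Type*} [NormedAddCommGroup E]

open scoped NNReal in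
theorem packingNumber_one_closedBall_two_le [NormedSpace ℝ E] [FiniteDimensional ℝ E] :
    Metric.packingNumber 1 (Metric.closedBall (0 : E) 2) ≤ (5 ^ Module.finrank ℝ E : ℕ) := by
  have hcard (s : Finset E) (hs : (s : Set E) ⊆ Metric.closedBall 0 2)
      (hsep : Metric.IsSeparated ((1 : ℝ≥0) : ENNReal) (s : Set E)) :
      s.card ≤ 5 ^ Module.finrank ℝ E := by
    refine Besicovitch.card_le_of_separated s (fun c hc => mem_closedBall_zero_iff.1 (hs hc))
      fun c hc d hd hcd => ?_
    have hlt : ((1 : ℝ≥0) : ENNReal) < edist c d := hsep hc hd hcd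
    rw [edist_dist, ENNReal.coe_one, ENNReal.one_lt_ofReal, dist_eq_norm] at hlt
    exact hlt.le
  refine iSup_le fun C => iSup₂_le fun hC hsep => ?_
  by_contra! hlt
  obtain ⟨s, hsC, hs⟩ := Set.exists_subset_encard_eq (Order.add_one_le_of_lt hlt)
  have hfin : s.Finite :=
    Set.finite_of_encard_eq_coe (k := 5 ^ Module.finrank ℝ E + 1) (by simpa using hs)
  have := hcard hfin.toFinset (by simpa using hsC.trans hC) (by simpa using hsep.subset hsC)
  rw [hfin.encard_eq_coe_toFinset_card] at hs
  norm_cast at hs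
  omega

theorem exists_finset_cover_closedBall_one [NormedSpace ℝ E] [FiniteDimensional ℝ E] :
    ∃ N : Finset E, N.card ≤ 5 ^ Module.finrank ℝ E ∧ (∀ x ∈ N, ‖x‖ ≤ 1) ∧
      ∀ v : E, ‖v‖ ≤ 1 → ∃ x ∈ N, ‖v - x‖ ≤ 1 / 2 := by
  classical
  have hcover := (Metric.coveringNumber_le_packingNumber 1 _).trans
    (packingNumber_one_closedBall_two_le (E := E))
  have htop := ne_top_of_le_ne_top (ENat.natCast_ne_top _) hcover
  set S := Metric.minimalCover 1 (Metric.closedBall (0 : E) 2)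
  have hfin : S.Finite := Metric.finite_minimalCover
  refine ⟨hfin.toFinset.image fun x => (1 / 2 : ℝ) • x, Finset.card_image_le.trans ?_, ?_, ?_⟩
  · rw [← Metric.encard_minimalCover htop, hfin.encard_eq_coe_toFinset_card] at hcover
    exact_mod_cast hcover
  · simp only [Finset.forall_mem_image, hfin.mem_toFinset, norm_smul]
    intro x hx
    have := mem_closedBall_zero_iff.1 (Metric.minimalCover_subset hx)
    norm_num
    linarith
  · intro v hv
    obtain ⟨x, hx, hvx⟩ := Metric.isCover_minimalCover htop (x := (2 : ℝ) • v) (by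
      rw [mem_closedBall_zero_iff, norm_smul, Real.norm_two]; linarith)
    refine ⟨_, Finset.mem_image_of_mem _ (hfin.mem_toFinset.2 hx), ?_⟩
    have hdist : ‖(2 : ℝ) • v - x‖ ≤ 1 := by
      simpa only [Set.mem_ofPred_eq, edist_dist, dist_eq_norm, ENNReal.coe_one,
        ENNReal.ofReal_le_one] using hvx
    rw [show v - (1 / 2 : ℝ) • x = (1 / 2 : ℝ) • ((2 : ℝ) • v - x) by module, norm_smul]
    norm_num
    linarith

variable [InnerProductSpace ℝ E]

theorem exists_norm_le_one_inner_eq_norm (v : E) : ∃ x : E, ‖x‖ ≤ 1 ∧ inner ℝ v x = ‖v‖ := by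
  refine ⟨‖v‖⁻¹ • v, ?_, ?_⟩
  · rw [norm_smul, norm_inv, norm_norm]
    exact inv_mul_le_one
  · rw [inner_smul_right, real_inner_self_eq_norm_mul_norm, ← mul_assoc, inv_mul_mul_self]

theorem exists_norming_finset [FiniteDimensional ℝ E] :
    ∃ N : Finset E, N.card ≤ 5 ^ Module.finrank ℝ E ∧ (∀ x ∈ N, ‖x‖ ≤ 1) ∧
      ∀ v, ∃ x ∈ N, ‖v‖ ≤ 2 * inner ℝ v x := by
  obtain ⟨N, hcard, hN, hcover⟩ := exists_finset_cover_closedBall_one (E := E)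
  refine ⟨N, hcard, hN, fun v => ?_⟩
  obtain ⟨w, hw, hvw⟩ := exists_norm_le_one_inner_eq_norm v
  obtain ⟨x, hx, hwx⟩ := hcover w hw
  refine ⟨x, hx, ?_⟩
  have hsub : inner ℝ v (w - x) ≤ ‖v‖ * (1 / 2) :=
    (real_inner_le_norm _ _).trans (mul_le_mul_of_nonneg_left hwx (norm_nonneg v))
  rw [inner_sub_right, hvw] at hsub
  linarith

end Net

section Tensor

variable {K : ℕ}

/-- The multilinear form `(x₁, …, x_K) ↦ ⟨T, x₁ ⊗ ⋯ ⊗ x_K⟩` attached to a tensor. Its maximum over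
unit vectors is the spectral norm of `T`. -/
def multiForm {d : Fin K → ℕ} (T : RealTensor d)
    (x : (k : Fin K) → EuclideanSpace ℝ (Fin (d k))) : ℝ :=
  ∑ i, T i * ∏ k, x k (i k)

/-- `T` is a linear combination of `R` rank-one tensors, that is, the rank of `T` is at most `R`.
The weights may have any sign and the vectors any length, so that the notion is stable under
differences and contractions. -/
def HasCPRankLE {d : Fin K → ℕ} (T : RealTensor d) (R : ℕ) : Prop :=
  ∃ (c : Fin R → ℝ) (a : Fin R → (k : Fin K) → EuclideanSpace ℝ (Fin (d k))),
    ∀ i, T i = ∑ r, c r * ∏ k, a r k (i k)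

theorem HasCPDecomposition.hasCPRankLE {d : Fin K → ℕ} {T : RealTensor d} {R : ℕ}
    (h : HasCPDecomposition T R) : HasCPRankLE T R :=
  let ⟨w, a, _, _, _, hT⟩ := h
  ⟨w, a, hT⟩

theorem HasCPRankLE.sub {d : Fin K → ℕ} {S T : RealTensor d} {R R' : ℕ} (hS : HasCPRankLE S R)
    (hT : HasCPRankLE T R') : HasCPRankLE (S - T) (R + R') := by
  obtain ⟨c, a, hS⟩ := hS
  obtain ⟨c', a', hT⟩ := hT
  refine ⟨Fin.append c (-c'), Fin.append a a', fun i => ?_⟩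
  simp [Fin.sum_univ_add, hS, hT, sub_eq_add_neg]

theorem sum_sq_prod_eq_prod_norm_sq {d : Fin K → ℕ}
    (x : (k : Fin K) → EuclideanSpace ℝ (Fin (d k))) :
    ∑ i : Idx d, (∏ k, x k (i k)) ^ 2 = ∏ k, ‖x k‖ ^ 2 := by
  simp only [EuclideanSpace.norm_sq_eq, Real.norm_eq_abs, sq_abs, Finset.prod_univ_sum,
    Fintype.piFinset_univ, Finset.prod_pow]

variable {d : Fin (K + 1) → ℕ}

/-- The mode-one fiber of `T` at the remaining indices `i`. -/
def firstFiber (T : RealTensor d) (i : Idx fun k : Fin K => d k.succ) :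
    EuclideanSpace ℝ (Fin (d 0)) :=
  WithLp.toLp 2 fun l => T (Fin.cons l i)

/-- The contraction of the first mode of `T` with the vector `v`. -/
def contractFirst (T : RealTensor d) (v : EuclideanSpace ℝ (Fin (d 0))) :
    RealTensor fun k : Fin K => d k.succ :=
  fun i => inner ℝ v (firstFiber T i)

theorem sum_idx_succ (g : Idx d → ℝ) :
    ∑ i, g i = ∑ i : Idx fun k : Fin K => d k.succ, ∑ l, g (Fin.cons l i) := by
  rw [← (Fin.consEquiv fun k => Fin (d k)).sum_comp, Fintype.sum_prod_type_right]
  rfl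

theorem sum_mul_eq_sum_inner_firstFiber (S T : RealTensor d) :
    ∑ i, S i * T i = ∑ i, inner ℝ (firstFiber S i) (firstFiber T i) := by
  simp only [sum_idx_succ, firstFiber, PiLp.inner_apply, RCLike.inner_apply, conj_trivial, mul_comm]

theorem multiForm_succ (T : RealTensor d) (x : (k : Fin (K + 1)) → EuclideanSpace ℝ (Fin (d k))) :
    multiForm T x = multiForm (contractFirst T (x 0)) fun k => x k.succ := by
  simp only [multiForm, sum_idx_succ, contractFirst, firstFiber, PiLp.inner_apply,
    RCLike.inner_apply, conj_trivial, Fin.prod_univ_succ, Fin.cons_zero, Fin.cons_succ,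
    Finset.sum_mul, mul_assoc]

theorem multiForm_contractFirst (T : RealTensor d) (v : EuclideanSpace ℝ (Fin (d 0)))
    (x : (k : Fin K) → EuclideanSpace ℝ (Fin (d k.succ))) :
    multiForm (contractFirst T v) x = inner ℝ v (∑ i, (∏ k, x k (i k)) • firstFiber T i) := by
  simp only [multiForm, contractFirst, inner_sum, inner_smul_right, mul_comm]

theorem exists_multiForm_le_of_norming {K : ℕ} {d : Fin K → ℕ}
    {N : (k : Fin K) → Finset (EuclideanSpace ℝ (Fin (d k)))}
    (hN : ∀ k v, ∃ x ∈ N k, ‖v‖ ≤ 2 * inner ℝ v x) (T : RealTensor d)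
    {x : (k : Fin K) → EuclideanSpace ℝ (Fin (d k))} (hx : ∀ k, ‖x k‖ ≤ 1) :
    ∃ y ∈ Fintype.piFinset N, multiForm T x ≤ 2 ^ K * multiForm T y := by
  induction K with
  | zero => exact ⟨x, Fintype.mem_piFinset.2 fun k => k.elim0, by simp⟩
  | succ K ih =>
    set v := ∑ i, (∏ k : Fin K, x k.succ (i k)) • firstFiber T i with hv
    obtain ⟨y₀, hy₀, hnorm⟩ := hN 0 v
    obtain ⟨y, hy, hle⟩ := ih (fun k => hN k.succ) (contractFirst T y₀) fun k => hx k.succ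
    refine ⟨Fin.cons y₀ y, Fintype.mem_piFinset.2 (Fin.cases hy₀ (Fintype.mem_piFinset.1 hy)), ?_⟩
    rw [multiForm_contractFirst, ← hv] at hle
    calc multiForm T x = inner ℝ (x 0) v := by rw [multiForm_succ, multiForm_contractFirst]
      _ ≤ ‖v‖ := (real_inner_le_norm _ _).trans (mul_le_of_le_one_left (norm_nonneg _) (hx 0))
      _ ≤ 2 * inner ℝ y₀ v := by rwa [real_inner_comm]
      _ ≤ 2 * (2 ^ K * multiForm (contractFirst T y₀) y) := by gcongr
      _ = 2 ^ (K + 1) * multiForm T (Fin.cons y₀ y) := by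
        rw [multiForm_succ, Fin.cons_zero, pow_succ']
        simp only [Fin.cons_succ, mul_assoc]

theorem HasCPRankLE.contractFirst {T : RealTensor d} {R : ℕ} (hT : HasCPRankLE T R)
    (v : EuclideanSpace ℝ (Fin (d 0))) : HasCPRankLE (contractFirst T v) R := by
  obtain ⟨c, a, hT⟩ := hT
  refine ⟨fun r => c r * inner ℝ v (a r 0), fun r k => a r k.succ, fun i => ?_⟩
  simp only [BinaryTensor.contractFirst, firstFiber, hT, Fin.prod_univ_succ, Fin.cons_zero,
    Fin.cons_succ, PiLp.inner_apply, RCLike.inner_apply, conj_trivial, Finset.mul_sum,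
    Finset.sum_mul]
  rw [Finset.sum_comm]
  exact Finset.sum_congr rfl fun r _ => Finset.sum_congr rfl fun l _ => by ring

theorem HasCPRankLE.exists_submodule_firstFiber_mem {T : RealTensor d} {R : ℕ}
    (hT : HasCPRankLE T R) :
    ∃ U : Submodule ℝ (EuclideanSpace ℝ (Fin (d 0))),
      Module.finrank ℝ U ≤ R ∧ ∀ i, firstFiber T i ∈ U := by
  obtain ⟨c, a, hT⟩ := hT
  refine ⟨Submodule.span ℝ (Set.range fun r => a r 0), ?_, fun i => ?_⟩
  · exact (finrank_range_le_card fun r => a r 0).trans_eq (Fintype.card_fin R)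
  have hfiber : firstFiber T i = ∑ r, (c r * ∏ k : Fin K, a r k.succ (i k)) • a r 0 := by
    ext l
    simp only [firstFiber, hT, Fin.prod_univ_succ, Fin.cons_zero, Fin.cons_succ, WithLp.ofLp_sum,
      WithLp.ofLp_smul, Finset.sum_apply, Pi.smul_apply, smul_eq_mul]
    exact Finset.sum_congr rfl fun r _ => by ring
  rw [hfiber]
  exact Submodule.sum_mem _ fun r _ => Submodule.smul_mem _ _ (Submodule.subset_span ⟨r, rfl⟩)

theorem sum_inner_mul_inner_of_mem {E J : Type*} [NormedAddCommGroup E] [InnerProductSpace ℝ E]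
    [Fintype J] {U : Submodule ℝ E} (b : OrthonormalBasis J ℝ U) (v : E) {w : E} (hw : w ∈ U) :
    ∑ j, inner ℝ (b j : E) v * inner ℝ (b j : E) w = inner ℝ v w := by
  have hexpand : w = ∑ j, inner ℝ (b j : E) w • (b j : E) := by
    simpa using congrArg Subtype.val (b.sum_repr' ⟨w, hw⟩).symm
  conv_rhs => rw [hexpand]
  simp only [inner_sum, inner_smul_right, real_inner_comm, mul_comm]

theorem sum_mul_eq_sum_contractFirst {J : Type*} [Fintype J] (S : RealTensor d) {T : RealTensor d}
    {U : Submodule ℝ (EuclideanSpace ℝ (Fin (d 0)))} (b : OrthonormalBasis J ℝ U)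
    (hU : ∀ i, firstFiber T i ∈ U) :
    ∑ i, S i * T i = ∑ j, ∑ i, contractFirst S (b j) i * contractFirst T (b j) i := by
  rw [sum_mul_eq_sum_inner_firstFiber, Finset.sum_comm]
  exact Finset.sum_congr rfl fun i _ => (sum_inner_mul_inner_of_mem b _ (hU i)).symm

theorem sum_mul_le_of_multiForm_le_of_order_one {d : Fin 1 → ℕ} (S T : RealTensor d) {s : ℝ}
    (hs : ∀ x, (∀ k, ‖x k‖ ≤ 1) → multiForm S x ≤ s) :
    ∑ i, S i * T i ≤ s * √(∑ i, T i ^ 2) := by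
  obtain ⟨x, hx, hinner⟩ := exists_norm_le_one_inner_eq_norm (firstFiber S default)
  have hS : ‖firstFiber S default‖ ≤ s := by
    have := hs (Fin.cons x finZeroElim) (Fin.cases hx finZeroElim)
    rwa [multiForm_succ, multiForm_contractFirst, Fintype.sum_unique, Finset.univ_eq_empty,
      Finset.prod_empty, one_smul, Fin.cons_zero, real_inner_comm, hinner] at this
  have hT : √(∑ i, T i ^ 2) = ‖firstFiber T default‖ := by
    simp only [sq, sum_mul_eq_sum_inner_firstFiber, Fintype.sum_unique,
      real_inner_self_eq_norm_mul_norm, Real.sqrt_mul_self (norm_nonneg _)]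
  rw [hT, sum_mul_eq_sum_inner_firstFiber, Fintype.sum_unique]
  exact (real_inner_le_norm _ _).trans (mul_le_mul_of_nonneg_right hS (norm_nonneg _))

/-- Splitting along an orthonormal basis of the span of the first-mode fibers, which has at most `R`
elements, costs a factor `√R` by Cauchy–Schwarz; after `K` steps a vector is left. -/
theorem sum_mul_le_of_multiForm_le {S T : RealTensor d} {R : ℕ} (hT : HasCPRankLE T R) {s : ℝ}
    (hs : ∀ x, (∀ k, ‖x k‖ ≤ 1) → multiForm S x ≤ s) :
    ∑ i, S i * T i ≤ s * √(R ^ K) * √(∑ i, T i ^ 2) := by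
  induction K with
  | zero => simpa using sum_mul_le_of_multiForm_le_of_order_one S T hs
  | succ K ih =>
    have hs0 : 0 ≤ s := by simpa [multiForm] using hs 0 (by simp)
    obtain ⟨U, hR, hU⟩ := hT.exists_submodule_firstFiber_mem
    let b := stdOrthonormalBasis ℝ U
    let q j := ∑ i, contractFirst T (b j) i ^ 2
    have hq : ∑ j, q j = ∑ i, T i ^ 2 := by
      simpa only [q, sq] using (sum_mul_eq_sum_contractFirst T b hU).symm
    have hcontract (j) : ∑ i, contractFirst S (b j) i * contractFirst T (b j) i ≤
        s * √(R ^ K) * √(q j) := by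
      refine ih (hT.contractFirst _) fun x hx => ?_
      have := hs (Fin.cons (b j) x) (Fin.cases (b.norm_eq_one j).le hx)
      rwa [multiForm_succ] at this
    have hcauchy : ∑ j, √(q j) ≤ √R * √(∑ i, T i ^ 2) := by
      have := Real.sum_sqrt_mul_sqrt_le Finset.univ (f := fun _ => 1) (g := q)
        (fun _ => zero_le_one) fun j => Finset.sum_nonneg fun i _ => sq_nonneg _
      simp only [Real.sqrt_one, one_mul, hq, Finset.sum_const, Finset.card_univ, Fintype.card_fin,
        nsmul_eq_mul, mul_one] at this
      exact this.trans (by gcongr)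
    calc ∑ i, S i * T i ≤ ∑ j, s * √(R ^ K) * √(q j) :=
          (sum_mul_eq_sum_contractFirst S b hU).trans_le (Finset.sum_le_sum fun j _ => hcontract j)
      _ ≤ s * √(R ^ K) * (√R * √(∑ i, T i ^ 2)) := by
          rw [← Finset.mul_sum]
          gcongr
      _ = s * √(R ^ (K + 1)) * √(∑ i, T i ^ 2) := by
          rw [pow_succ, Real.sqrt_mul (by positivity)]
          ring

end Tensor

section LogOdds

theorem monotoneOn_of_hasDerivAt_nonneg {D : Set ℝ} (hD : Convex ℝ D) {f f' : ℝ → ℝ}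
    (hf : ∀ x ∈ D, HasDerivAt f (f' x) x) (hf' : ∀ x ∈ D, 0 ≤ f' x) : MonotoneOn f D :=
  monotoneOn_of_hasDerivWithinAt_nonneg hD (fun x hx => (hf x hx).continuousAt.continuousWithinAt)
    (fun x hx => (hf x (interior_subset hx)).hasDerivWithinAt)
    fun x hx => hf' x (interior_subset hx)

theorem abs_sub_le_and_le_abs_sub_of_monotoneOn {h : ℝ → ℝ} {l L : ℝ} {S : Set ℝ} (hl : 0 ≤ l)
    (hlower : MonotoneOn (fun t => h t - l * t) S) (hupper : MonotoneOn (fun t => L * t - h t) S)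
    {s t : ℝ} (hs : s ∈ S) (ht : t ∈ S) :
    |h s - h t| ≤ L * |s - t| ∧ l * |s - t| ≤ |h s - h t| := by
  wlog hts : t ≤ s generalizing s t
  · rw [abs_sub_comm (h s), abs_sub_comm s]
    exact this ht hs (le_of_not_ge hts)
  have hle : h t - l * t ≤ h s - l * s := hlower ht hs hts
  have hge : L * t - h t ≤ L * s - h s := hupper ht hs hts
  have hnonneg : 0 ≤ l * (s - t) := mul_nonneg hl (sub_nonneg.2 hts)
  rw [abs_of_nonneg (sub_nonneg.2 hts), abs_of_nonneg (by linarith)]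
  constructor <;> linarith

/-- The log-odds `log (x / (1 - x))`, the natural parameter of the Bernoulli law with mean `x`. It
is written as a difference of logarithms, and is meant for `x` in the open unit interval only. -/
def logit (x : ℝ) : ℝ := Real.log x - Real.log (1 - x)

/-- The Kullback-Leibler divergence of the Bernoulli law with mean `q` from the one with mean `p`,
meant for `p` and `q` in the open unit interval. -/
def bernoulliKL (p q : ℝ) : ℝ :=
  p * (Real.log p - Real.log q) + (1 - p) * (Real.log (1 - p) - Real.log (1 - q))

theorem hasDerivAt_log_one_sub {x : ℝ} (hx : x < 1) :
    HasDerivAt (fun x => Real.log (1 - x)) (-1 / (1 - x)) x :=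
  ((hasDerivAt_id x).const_sub 1).log (sub_pos.2 hx).ne'

theorem hasDerivAt_logit {x : ℝ} (hx : x ∈ Set.Ioo 0 1) :
    HasDerivAt logit (1 / (x * (1 - x))) x := by
  have h0 : x ≠ 0 := hx.1.ne'
  have h1 : 1 - x ≠ 0 := (sub_pos.2 hx.2).ne'
  refine ((Real.hasDerivAt_log h0).sub (hasDerivAt_log_one_sub hx.2)).congr_deriv ?_
  field_simp
  ring

theorem logit_one_sub (x : ℝ) : logit (1 - x) = -logit x := by
  rw [logit, logit, sub_sub_cancel, neg_sub]

theorem bernoulliKL_one_sub (p q : ℝ) : bernoulliKL (1 - p) (1 - q) = bernoulliKL p q := by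
  simp only [bernoulliKL, sub_sub_cancel]
  ring

theorem hasDerivAt_bernoulliKL (p : ℝ) {x : ℝ} (hx : x ∈ Set.Ioo 0 1) :
    HasDerivAt (bernoulliKL p) ((x - p) / (x * (1 - x))) x := by
  have h0 : x ≠ 0 := hx.1.ne'
  have h1 : 1 - x ≠ 0 := (sub_pos.2 hx.2).ne'
  refine ((((Real.hasDerivAt_log h0).const_sub (Real.log p)).const_mul p).add
    (((hasDerivAt_log_one_sub hx.2).const_sub (Real.log (1 - p))).const_mul (1 - p))).congr_deriv ?_
  field_simp
  ring

theorem le_mul_one_sub_of_mem_Icc {p q x m : ℝ} (hp : m ≤ p * (1 - p)) (hq : m ≤ q * (1 - q))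
    (hx : x ∈ Set.Icc p q) : m ≤ x * (1 - x) := by
  obtain ⟨hpx, hxq⟩ := hx
  rcases le_total (x + p) 1 with h | h <;> nlinarith

theorem mul_logit_sub_le_sub {p q m : ℝ} (hp : 0 < p) (hq : q < 1) (hpq : p ≤ q)
    (hmp : m ≤ p * (1 - p)) (hmq : m ≤ q * (1 - q)) : m * (logit q - logit p) ≤ q - p := by
  have hmem : ∀ x ∈ Set.Icc p q, x ∈ Set.Ioo 0 1 := fun x hx =>
    ⟨hp.trans_le hx.1, hx.2.trans_lt hq⟩
  have hmono : MonotoneOn (fun x => x - m * logit x) (Set.Icc p q) := by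
    refine monotoneOn_of_hasDerivAt_nonneg (convex_Icc p q)
      (fun x hx => (hasDerivAt_id x).sub ((hasDerivAt_logit (hmem x hx)).const_mul m))
      fun x hx => ?_
    have hvar : 0 < x * (1 - x) := mul_pos (hmem x hx).1 (sub_pos.2 (hmem x hx).2)
    rw [sub_nonneg, mul_one_div]
    exact div_le_one_of_le₀ (le_mul_one_sub_of_mem_Icc hmp hmq hx) hvar.le
  have hle : p - m * logit p ≤ q - m * logit q :=
    hmono (Set.left_mem_Icc.2 hpq) (Set.right_mem_Icc.2 hpq) hpq
  linarith

theorem mul_logit_sub_sq_le_bernoulliKL {p q m : ℝ} (hp : p ∈ Set.Ioo 0 1)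
    (hq : q ∈ Set.Ioo 0 1) (hmp : m ≤ p * (1 - p)) (hmq : m ≤ q * (1 - q)) :
    m / 2 * (logit q - logit p) ^ 2 ≤ bernoulliKL p q := by
  wlog hpq : p ≤ q generalizing p q
  · have hsymm := this (p := 1 - p) (q := 1 - q) ⟨by linarith [hp.2], by linarith [hp.1]⟩
      ⟨by linarith [hq.2], by linarith [hq.1]⟩ (by linarith) (by linarith) (by linarith)
    rw [bernoulliKL_one_sub, logit_one_sub, logit_one_sub] at hsymm
    linarith
  have hmem : ∀ x ∈ Set.Icc p q, x ∈ Set.Ioo 0 1 := fun x hx =>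
    ⟨hp.1.trans_le hx.1, hx.2.trans_lt hq.2⟩
  have hderiv : ∀ x ∈ Set.Icc p q,
      HasDerivAt (fun x => bernoulliKL p x - m / 2 * (logit x - logit p) ^ 2)
        ((x - p - m * (logit x - logit p)) / (x * (1 - x))) x := fun x hx => by
    refine ((hasDerivAt_bernoulliKL p (hmem x hx)).sub
      ((((hasDerivAt_logit (hmem x hx)).sub_const (logit p)).pow 2).const_mul
        (m / 2))).congr_deriv ?_
    ring
  have hmono := monotoneOn_of_hasDerivAt_nonneg (convex_Icc p q) hderiv fun x hx => by
    have hvar : 0 < x * (1 - x) := mul_pos (hmem x hx).1 (sub_pos.2 (hmem x hx).2)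
    have hle := mul_logit_sub_le_sub hp.1 (hmem x hx).2 hx.1 hmp
      (le_mul_one_sub_of_mem_Icc hmp hmq hx)
    exact div_nonneg (by linarith) hvar.le
  have hle := hmono (Set.left_mem_Icc.2 hpq) (Set.right_mem_Icc.2 hpq) hpq
  simp only [bernoulliKL, sub_self] at hle ⊢
  linarith

end LogOdds

section LinkRegular

/-- Quantitative regularity of a link function `f` on `S`: its Bernoulli variance `f (1 - f)` is at
least `m`, and its log-odds are bi-Lipschitz with constants `l` and `L`. The error of the
maximum likelihood estimator is governed by the ratio `L / (m l ^ 2)`. -/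
structure LinkRegular (f : ℝ → ℝ) (S : Set ℝ) (m l L : ℝ) : Prop where
  m_pos : 0 < m
  l_pos : 0 < l
  L_pos : 0 < L
  mem_Ioo : ∀ θ ∈ S, f θ ∈ Set.Ioo 0 1
  le_variance : ∀ θ ∈ S, m ≤ f θ * (1 - f θ)
  abs_logit_sub_le : ∀ θ ∈ S, ∀ θ' ∈ S, |logit (f θ) - logit (f θ')| ≤ L * |θ - θ'|
  le_abs_logit_sub : ∀ θ ∈ S, ∀ θ' ∈ S, l * |θ - θ'| ≤ |logit (f θ) - logit (f θ')|

theorem LinkRegular.comp_div {f : ℝ → ℝ} {S T : Set ℝ} {m l L σ : ℝ} (h : LinkRegular f S m l L)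
    (hσ : 0 < σ) (hST : Set.MapsTo (· / σ) T S) :
    LinkRegular (fun θ => f (θ / σ)) T m (l / σ) (L / σ) := by
  have hdist : ∀ c θ θ' : ℝ, c / σ * |θ - θ'| = c * |θ / σ - θ' / σ| := fun c θ θ' => by
    rw [← sub_div, abs_div, abs_of_pos hσ, div_mul_eq_mul_div, mul_div_assoc]
  exact
    { m_pos := h.m_pos
      l_pos := div_pos h.l_pos hσ
      L_pos := div_pos h.L_pos hσ
      mem_Ioo := fun θ hθ => h.mem_Ioo _ (hST hθ)
      le_variance := fun θ hθ => h.le_variance _ (hST hθ)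
      abs_logit_sub_le := fun θ hθ θ' hθ' => by
        rw [hdist]
        exact h.abs_logit_sub_le _ (hST hθ) _ (hST hθ')
      le_abs_logit_sub := fun θ hθ θ' hθ' => by
        rw [hdist]
        exact h.le_abs_logit_sub _ (hST hθ) _ (hST hθ') }

theorem LinkRegular.of_monotoneOn {f : ℝ → ℝ} {S : Set ℝ} {m l L : ℝ} (hm : 0 < m) (hl : 0 < l)
    (hL : 0 < L) (hf : ∀ θ ∈ S, f θ ∈ Set.Ioo 0 1) (hvar : ∀ θ ∈ S, m ≤ f θ * (1 - f θ))
    (hlower : MonotoneOn (fun θ => logit (f θ) - l * θ) S)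
    (hupper : MonotoneOn (fun θ => L * θ - logit (f θ)) S) : LinkRegular f S m l L where
  m_pos := hm
  l_pos := hl
  L_pos := hL
  mem_Ioo := hf
  le_variance := hvar
  abs_logit_sub_le _ hθ _ hθ' :=
    (abs_sub_le_and_le_abs_sub_of_monotoneOn hl.le hlower hupper hθ hθ').1
  le_abs_logit_sub _ hθ _ hθ' :=
    (abs_sub_le_and_le_abs_sub_of_monotoneOn hl.le hlower hupper hθ hθ').2

theorem LinkRegular.mul_sub_sq_le_bernoulliKL {f : ℝ → ℝ} {S : Set ℝ} {m l L : ℝ}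
    (h : LinkRegular f S m l L) {θ θ' : ℝ} (hθ : θ ∈ S) (hθ' : θ' ∈ S) :
    m * l ^ 2 / 2 * (θ' - θ) ^ 2 ≤ bernoulliKL (f θ) (f θ') := by
  have hm := h.m_pos
  have hl := h.l_pos
  calc m * l ^ 2 / 2 * (θ' - θ) ^ 2 = m / 2 * (l * |θ' - θ|) ^ 2 := by rw [mul_pow, sq_abs]; ring
    _ ≤ m / 2 * |logit (f θ') - logit (f θ)| ^ 2 := by
        gcongr
        exact h.le_abs_logit_sub θ' hθ' θ hθ
    _ = m / 2 * (logit (f θ') - logit (f θ)) ^ 2 := by rw [sq_abs]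
    _ ≤ _ := mul_logit_sub_sq_le_bernoulliKL (h.mem_Ioo θ hθ) (h.mem_Ioo θ' hθ')
        (h.le_variance θ hθ) (h.le_variance θ' hθ')

end LinkRegular

section Logistic

theorem logit_sigmoid (t : ℝ) : logit (Real.sigmoid t) = t := by
  rw [logit, ← Real.sigmoid_neg, ← Real.sigmoid_mul_rexp_neg,
    Real.log_mul (Real.sigmoid_pos t).ne' (Real.exp_pos _).ne', Real.log_exp]
  ring

theorem sigmoid_mul_one_sub (t : ℝ) :
    Real.sigmoid t * (1 - Real.sigmoid t) = 1 / (2 * (1 + Real.cosh t)) := by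
  have hprod : Real.exp t * Real.exp (-t) = 1 := by
    rw [← Real.exp_add, add_neg_cancel, Real.exp_zero]
  have hcosh : 2 * (1 + Real.cosh t) = (1 + Real.exp t) * (1 + Real.exp (-t)) := by
    rw [Real.cosh_eq]
    linear_combination -hprod
  rw [← Real.sigmoid_neg, Real.sigmoid_def, Real.sigmoid_def, neg_neg, hcosh, ← mul_inv, one_div,
    mul_comm]

theorem linkRegular_sigmoid (x : ℝ) :
    LinkRegular Real.sigmoid (Set.Icc (-x) x) (1 / (2 * (1 + Real.cosh x))) 1 1 where
  m_pos := by positivity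
  l_pos := one_pos
  L_pos := one_pos
  mem_Ioo t _ := ⟨Real.sigmoid_pos t, Real.sigmoid_lt_one t⟩
  le_variance t ht := by
    have hcosh : Real.cosh t ≤ Real.cosh x :=
      Real.cosh_le_cosh.2 ((abs_le.2 ht).trans (le_abs_self x))
    rw [sigmoid_mul_one_sub]
    gcongr
  abs_logit_sub_le t _ t' _ := by rw [logit_sigmoid, logit_sigmoid, one_mul]
  le_abs_logit_sub t _ t' _ := by rw [logit_sigmoid, logit_sigmoid, one_mul]

end Logistic

section Laplace

/-- The distribution function of the Laplace law with unit scale. -/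
def laplaceCDF (t : ℝ) : ℝ :=
  if t < 0 then 1 / 2 * Real.exp t else 1 - 1 / 2 * Real.exp (-t)

theorem laplaceCDF_of_nonneg {t : ℝ} (ht : 0 ≤ t) : laplaceCDF t = 1 - 1 / 2 * Real.exp (-t) :=
  if_neg ht.not_gt

theorem laplaceCDF_neg (t : ℝ) : laplaceCDF (-t) = 1 - laplaceCDF t := by
  rcases lt_trichotomy t 0 with ht | rfl | ht
  · rw [laplaceCDF_of_nonneg (by linarith), laplaceCDF, if_pos ht, neg_neg]
  · rw [neg_zero, laplaceCDF_of_nonneg le_rfl, neg_zero, Real.exp_zero]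
    norm_num
  · rw [laplaceCDF_of_nonneg ht.le, laplaceCDF, if_pos (by linarith)]
    ring

theorem laplaceCDF_mem_Ioo (t : ℝ) : laplaceCDF t ∈ Set.Ioo 0 1 := by
  wlog ht : 0 ≤ t generalizing t
  · have hneg := this (-t) (by linarith)
    rw [laplaceCDF_neg] at hneg
    exact ⟨by linarith [hneg.2], by linarith [hneg.1]⟩
  have hexp : Real.exp (-t) ≤ 1 := Real.exp_le_one_iff.2 (by linarith)
  rw [laplaceCDF_of_nonneg ht]
  exact ⟨by linarith, by linarith [Real.exp_pos (-t)]⟩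

theorem exp_neg_abs_le_laplaceCDF_mul_one_sub (t : ℝ) :
    1 / 4 * Real.exp (-|t|) ≤ laplaceCDF t * (1 - laplaceCDF t) := by
  wlog ht : 0 ≤ t generalizing t
  · have hneg := this (-t) (by linarith)
    rw [abs_neg, laplaceCDF_neg] at hneg
    linarith
  have hpos := Real.exp_pos (-t)
  have hexp : Real.exp (-t) ≤ 1 := Real.exp_le_one_iff.2 (by linarith)
  rw [laplaceCDF_of_nonneg ht, abs_of_nonneg ht]
  nlinarith

theorem logit_laplaceCDF_neg (t : ℝ) : logit (laplaceCDF (-t)) = -logit (laplaceCDF t) := by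
  rw [laplaceCDF_neg, logit_one_sub]

theorem logit_laplaceCDF_of_nonneg {t : ℝ} (ht : 0 ≤ t) :
    logit (laplaceCDF t) = t + Real.log (2 - Real.exp (-t)) := by
  have hexp : Real.exp (-t) ≤ 1 := Real.exp_le_one_iff.2 (by linarith)
  have hfactor : 1 - 1 / 2 * Real.exp (-t) = 1 / 2 * (2 - Real.exp (-t)) := by ring
  rw [laplaceCDF_of_nonneg ht, logit, sub_sub_cancel, hfactor,
    Real.log_mul (by norm_num) (Real.exp_pos _).ne', Real.log_exp,
    Real.log_mul (by norm_num) (by linarith)]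
  ring

theorem log_two_sub_exp_neg_le {s t : ℝ} (hs : 0 ≤ s) (hst : s ≤ t) :
    Real.log (2 - Real.exp (-s)) ≤ Real.log (2 - Real.exp (-t)) := by
  have hexp : Real.exp (-s) ≤ 1 := Real.exp_le_one_iff.2 (by linarith)
  have hanti : Real.exp (-t) ≤ Real.exp (-s) := Real.exp_le_exp.2 (by linarith)
  exact Real.log_le_log (by linarith) (by linarith)

theorem log_two_sub_exp_neg_sub_le {s t : ℝ} (hs : 0 ≤ s) (hst : s ≤ t) :
    Real.log (2 - Real.exp (-t)) - Real.log (2 - Real.exp (-s)) ≤ t - s := by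
  have hs1 : Real.exp (-s) ≤ 1 := Real.exp_le_one_iff.2 (by linarith)
  have ht1 : Real.exp (-t) ≤ 1 := Real.exp_le_one_iff.2 (by linarith)
  have hgrow : 1 ≤ Real.exp (t - s) := Real.one_le_exp (by linarith)
  have hsplit : Real.exp (-s) = Real.exp (-t) * Real.exp (t - s) := by
    rw [← Real.exp_add, neg_add_eq_sub, sub_sub_cancel_left]
  rw [← Real.log_div (by linarith) (by linarith), Real.log_le_iff_le_exp
    (div_pos (by linarith) (by linarith)), div_le_iff₀ (by linarith)]
  nlinarith

theorem monotone_logit_laplaceCDF_sub : Monotone fun t => logit (laplaceCDF t) - 1 * t := by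
  refine monotone_of_odd_of_monotoneOn_nonneg (fun t => ?_) fun s hs t ht hst => ?_
  · rw [logit_laplaceCDF_neg]
    ring
  · simp only [logit_laplaceCDF_of_nonneg hs, logit_laplaceCDF_of_nonneg ht]
    linarith [log_two_sub_exp_neg_le hs hst]

theorem monotone_two_mul_sub_logit_laplaceCDF :
    Monotone fun t => 2 * t - logit (laplaceCDF t) := by
  refine monotone_of_odd_of_monotoneOn_nonneg (fun t => ?_) fun s hs t ht hst => ?_
  · rw [logit_laplaceCDF_neg]
    ring
  · simp only [logit_laplaceCDF_of_nonneg hs, logit_laplaceCDF_of_nonneg ht]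
    linarith [log_two_sub_exp_neg_sub_le hs hst]

theorem linkRegular_laplaceCDF (x : ℝ) :
    LinkRegular laplaceCDF (Set.Icc (-x) x) (1 / 4 * Real.exp (-x)) 1 2 := by
  refine .of_monotoneOn (by positivity) one_pos two_pos (fun t _ => laplaceCDF_mem_Ioo t)
    (fun t ht => ?_) (monotone_logit_laplaceCDF_sub.monotoneOn _)
    (monotone_two_mul_sub_logit_laplaceCDF.monotoneOn _)
  have htx : |t| ≤ x := abs_le.2 ht
  exact le_trans (by gcongr) (exp_neg_abs_le_laplaceCDF_mul_one_sub t)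

end Laplace

section Probit

local notation "Φ" => cdf (gaussianReal 0 1)
local notation "φ" => gaussianPDFReal 0 1

theorem gaussianPDFReal_zero_one (x : ℝ) :
    φ x = (√(2 * Real.pi))⁻¹ * Real.exp (-x ^ 2 / 2) := by
  simp [gaussianPDFReal]

theorem gaussianPDFReal_zero_one_abs (x : ℝ) : φ |x| = φ x := by
  rw [gaussianPDFReal_zero_one, gaussianPDFReal_zero_one, sq_abs]

theorem antitoneOn_gaussianPDFReal_zero_one : AntitoneOn φ (Set.Ici 0) := by
  intro x hx y _ hxy
  have hx0 : (0 : ℝ) ≤ x := hx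
  rw [gaussianPDFReal_zero_one, gaussianPDFReal_zero_one]
  gcongr

theorem cdf_gaussianReal_eq_integral (x : ℝ) : Φ x = ∫ t in Set.Iic x, φ t := by
  rw [cdf_eq_real, measureReal_def, gaussianReal_apply_eq_integral _ one_ne_zero,
    ENNReal.toReal_ofReal (integral_nonneg fun t => gaussianPDFReal_nonneg _ _ _)]

theorem hasDerivAt_cdf_gaussianReal (x : ℝ) : HasDerivAt Φ (φ x) x := by
  have hcont : Continuous φ := by
    rw [funext gaussianPDFReal_zero_one]
    fun_prop
  have hΦ : ⇑Φ = fun y => Φ 0 + ∫ t in (0 : ℝ)..y, φ t := by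
    funext y
    have h_integrable := integrable_gaussianPDFReal 0 1
    rw [← intervalIntegral.integral_Iic_sub_Iic h_integrable.integrableOn h_integrable.integrableOn,
      ← cdf_gaussianReal_eq_integral, ← cdf_gaussianReal_eq_integral, add_sub_cancel]
  rw [hΦ]
  exact (hcont.integral_hasStrictDerivAt 0 x).hasDerivAt.const_add _

theorem one_sub_cdf_gaussianReal (x : ℝ) : 1 - Φ x = (gaussianReal 0 1).real (Set.Ici x) := by
  have := nullSingletonClass_gaussianReal (μ := 0) (v := 1) one_ne_zero
  rw [cdf_eq_real, ← probReal_compl_eq_one_sub measurableSet_Iic, Set.compl_Iic]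
  exact measureReal_congr Ioi_ae_eq_Ici

theorem cdf_gaussianReal_neg (x : ℝ) : Φ (-x) = 1 - Φ x := by
  have hsymm : (gaussianReal 0 1).map (fun x : ℝ => -x) = gaussianReal 0 1 := by
    rw [gaussianReal_map_neg, neg_zero]
  have hpre : (fun x : ℝ => -x) ⁻¹' Set.Iic (-x) = Set.Ici x := by
    ext y
    simp
  rw [one_sub_cdf_gaussianReal, cdf_eq_real]
  nth_rewrite 1 [← hsymm]
  rw [map_measureReal_apply measurable_neg measurableSet_Iic, hpre]

theorem one_sub_cdf_gaussianReal_le {x : ℝ} (hx : 0 ≤ x) :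
    1 - Φ x ≤ √(2 * Real.pi) * φ x := by
  have hchernoff := measure_ge_le_exp_mul_mgf (X := id) (μ := gaussianReal 0 1) x hx
    (integrable_exp_mul_gaussianReal x)
  rw [mgf_id_gaussianReal, ← Real.exp_add] at hchernoff
  rw [one_sub_cdf_gaussianReal, gaussianPDFReal_zero_one, mul_inv_cancel_left₀ (by positivity)]
  convert hchernoff using 2
  · rfl
  · push_cast
    ring

-- Integrate the density over `[x, x + 1 / (1 + x)]`, where it loses at most a factor `e^{-3/2}`.
theorem le_one_sub_cdf_gaussianReal {x : ℝ} (hx : 0 ≤ x) :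
    Real.exp (-(3 / 2)) / (1 + x) * φ x ≤ 1 - Φ x := by
  set δ := 1 / (1 + x) with hδ
  have hδ0 : 0 < δ := by positivity
  have hδx : δ * (1 + x) = 1 := one_div_mul_cancel (by positivity)
  have hmean : φ (x + δ) * (x + δ - x) ≤ Φ (x + δ) - Φ x := by
    refine (convex_Icc x (x + δ)).mul_sub_le_image_sub_of_le_deriv
      (fun y _ => (hasDerivAt_cdf_gaussianReal y).continuousAt.continuousWithinAt)
      (fun y _ => (hasDerivAt_cdf_gaussianReal y).differentiableAt.differentiableWithinAt)
      (fun y hy => ?_) x ⟨le_rfl, by linarith⟩ (x + δ) ⟨by linarith, le_rfl⟩ (by linarith)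
    have hy := interior_subset hy
    rw [(hasDerivAt_cdf_gaussianReal y).deriv]
    exact antitoneOn_gaussianPDFReal_zero_one (hx.trans hy.1) (Set.mem_Ici.2 (by positivity)) hy.2
  have hdensity : Real.exp (-(3 / 2)) * φ x ≤ φ (x + δ) := by
    rw [gaussianPDFReal_zero_one, gaussianPDFReal_zero_one, mul_left_comm, ← Real.exp_add]
    gcongr
    have hδ1 : δ ≤ 1 := by nlinarith
    nlinarith
  calc _ = δ * (Real.exp (-(3 / 2)) * φ x) := by rw [hδ]; ring
    _ ≤ δ * φ (x + δ) := by gcongr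
    _ ≤ _ := by linarith [cdf_le_one (gaussianReal 0 1) (x + δ)]

theorem half_le_cdf_gaussianReal {x : ℝ} (hx : 0 ≤ x) : 1 / 2 ≤ Φ x := by
  have hzero := cdf_gaussianReal_neg 0
  rw [neg_zero] at hzero
  linarith [monotone_cdf (gaussianReal 0 1) hx]

theorem cdf_gaussianReal_mul_one_sub_abs (x : ℝ) : Φ |x| * (1 - Φ |x|) = Φ x * (1 - Φ x) := by
  rcases abs_choice x with h | h
  · rw [h]
  · rw [h, cdf_gaussianReal_neg]
    ring

theorem le_cdf_gaussianReal_mul_one_sub (x : ℝ) :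
    Real.exp (-(3 / 2)) / (2 * (1 + |x|)) * φ x ≤ Φ x * (1 - Φ x) := by
  rw [← cdf_gaussianReal_mul_one_sub_abs, ← gaussianPDFReal_zero_one_abs]
  calc _ = 1 / 2 * (Real.exp (-(3 / 2)) / (1 + |x|) * φ |x|) := by field_simp
    _ ≤ 1 / 2 * (1 - Φ |x|) := by
        gcongr
        exact le_one_sub_cdf_gaussianReal (abs_nonneg x)
    _ ≤ _ := mul_le_mul_of_nonneg_right (half_le_cdf_gaussianReal (abs_nonneg x))
        (sub_nonneg.2 (cdf_le_one _ _))

theorem cdf_gaussianReal_mul_one_sub_le (x : ℝ) :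
    Φ x * (1 - Φ x) ≤ √(2 * Real.pi) * φ x := by
  rw [← cdf_gaussianReal_mul_one_sub_abs, ← gaussianPDFReal_zero_one_abs]
  exact (mul_le_of_le_one_left (sub_nonneg.2 (cdf_le_one _ _)) (cdf_le_one _ _)).trans
    (one_sub_cdf_gaussianReal_le (abs_nonneg x))

theorem cdf_gaussianReal_mul_one_sub_pos (x : ℝ) : 0 < Φ x * (1 - Φ x) :=
  (mul_pos (by positivity) (gaussianPDFReal_pos _ _ _ one_ne_zero)).trans_le
    (le_cdf_gaussianReal_mul_one_sub x)

theorem cdf_gaussianReal_mem_Ioo (x : ℝ) : Φ x ∈ Set.Ioo 0 1 :=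
  ⟨pos_of_mul_pos_left (cdf_gaussianReal_mul_one_sub_pos x) (sub_nonneg.2 (cdf_le_one _ _)),
    sub_pos.1 (pos_of_mul_pos_right (cdf_gaussianReal_mul_one_sub_pos x) (cdf_nonneg _ _))⟩

theorem hasDerivAt_logit_cdf_gaussianReal (x : ℝ) :
    HasDerivAt (fun x => logit (Φ x)) (φ x / (Φ x * (1 - Φ x))) x :=
  ((hasDerivAt_logit (cdf_gaussianReal_mem_Ioo x)).comp x
    (hasDerivAt_cdf_gaussianReal x)).congr_deriv (one_div_mul_eq_div _ _)

theorem inv_sqrt_two_pi_le_gaussianPDFReal_div (x : ℝ) :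
    (√(2 * Real.pi))⁻¹ ≤ φ x / (Φ x * (1 - Φ x)) := by
  rw [le_div_iff₀ (cdf_gaussianReal_mul_one_sub_pos x), inv_mul_le_iff₀ (by positivity)]
  exact cdf_gaussianReal_mul_one_sub_le x

theorem gaussianPDFReal_div_le (x : ℝ) :
    φ x / (Φ x * (1 - Φ x)) ≤ 2 * (1 + |x|) * Real.exp (3 / 2) := by
  rw [div_le_iff₀ (cdf_gaussianReal_mul_one_sub_pos x)]
  calc φ x = 2 * (1 + |x|) * Real.exp (3 / 2) *
        (Real.exp (-(3 / 2)) / (2 * (1 + |x|)) * φ x) := by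
        rw [Real.exp_neg]
        field_simp
    _ ≤ _ := mul_le_mul_of_nonneg_left (le_cdf_gaussianReal_mul_one_sub x) (by positivity)

theorem linkRegular_cdf_gaussianReal {x : ℝ} (hx : 0 ≤ x) :
    LinkRegular Φ (Set.Icc (-x) x) (Real.exp (-(3 / 2)) / (2 * (1 + x)) * φ x)
      (√(2 * Real.pi))⁻¹ (2 * (1 + x) * Real.exp (3 / 2)) := by
  refine .of_monotoneOn (mul_pos (by positivity) (gaussianPDFReal_pos _ _ _ one_ne_zero))
    (by positivity) (by positivity) (fun t _ => cdf_gaussianReal_mem_Ioo t) (fun t ht => ?_) ?_ ?_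
  · have htx : |t| ≤ x := abs_le.2 ht
    have hφ : φ x ≤ φ t := by
      rw [← gaussianPDFReal_zero_one_abs t]
      exact antitoneOn_gaussianPDFReal_zero_one (abs_nonneg t) hx htx
    have hφ0 : 0 ≤ φ x := gaussianPDFReal_nonneg 0 1 x
    exact le_trans (by gcongr) (le_cdf_gaussianReal_mul_one_sub t)
  · refine monotoneOn_of_hasDerivAt_nonneg (convex_Icc _ _)
      (fun t _ => (hasDerivAt_logit_cdf_gaussianReal t).sub ((hasDerivAt_id t).const_mul _))
      fun t _ => ?_
    rw [mul_one, sub_nonneg]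
    exact inv_sqrt_two_pi_le_gaussianPDFReal_div t
  · refine monotoneOn_of_hasDerivAt_nonneg (convex_Icc _ _)
      (fun t _ => ((hasDerivAt_id t).const_mul _).sub (hasDerivAt_logit_cdf_gaussianReal t))
      fun t ht => ?_
    have htx : |t| ≤ x := abs_le.2 ht
    rw [mul_one, sub_nonneg]
    exact (gaussianPDFReal_div_le t).trans (by gcongr)

end Probit

section ScaleFactor

theorem mapsTo_div_Icc {α σ : ℝ} (hσ : 0 < σ) :
    Set.MapsTo (· / σ) (Set.Icc (-α) α) (Set.Icc (-(α / σ)) (α / σ)) := by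
  rintro θ ⟨hl, hr⟩
  rw [← neg_div]
  exact ⟨div_le_div_of_nonneg_right hl hσ.le, div_le_div_of_nonneg_right hr hσ.le⟩

theorem exists_linkRegular_logistic {α σ : ℝ} (hσ : 0 < σ) :
    ∃ m l L, LinkRegular (Link.logistic.fn σ) (Set.Icc (-α) α) m l L ∧
      L / (m * l ^ 2) = Link.logistic.scaleFactor 1 1 1 α σ := by
  have hfn : Link.logistic.fn σ = fun θ => Real.sigmoid (θ / σ) := by
    funext θ
    rw [Link.fn, Real.sigmoid_def, neg_div]
  rw [hfn]
  refine ⟨_, _, _, (linkRegular_sigmoid (α / σ)).comp_div hσ (mapsTo_div_Icc hσ), ?_⟩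
  have := Real.cosh_pos (α / σ)
  calc _ = σ * (2 * (1 + Real.cosh (α / σ))) := by field_simp
    _ = _ := by
      rw [Link.scaleFactor, Real.cosh_eq, neg_div]
      ring

theorem exists_linkRegular_laplacian {α σ : ℝ} (hσ : 0 < σ) :
    ∃ m l L, LinkRegular (Link.laplacian.fn σ) (Set.Icc (-α) α) m l L ∧
      L / (m * l ^ 2) = 8 * Link.laplacian.scaleFactor 1 1 1 α σ := by
  have hfn : Link.laplacian.fn σ = fun θ => laplaceCDF (θ / σ) := by
    funext θ
    rw [Link.fn, laplaceCDF, neg_div]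
    simp only [div_neg_iff, hσ, hσ.not_gt, and_true, and_false, false_or]
  rw [hfn]
  refine ⟨_, _, _, (linkRegular_laplaceCDF (α / σ)).comp_div hσ (mapsTo_div_Icc hσ), ?_⟩
  rw [Link.scaleFactor, Real.exp_neg]
  field_simp
  norm_num

theorem one_add_sq_le_exp (x : ℝ) : (1 + x) ^ 2 ≤ 4 * Real.exp (x ^ 2 / 2) := by
  nlinarith [Real.add_one_le_exp (x ^ 2 / 2), sq_nonneg (x - 1)]

theorem one_sixth_le_div {α σ : ℝ} (hα : 0 < α) (hσ : 0 < σ) :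
    1 / 6 ≤ (α + σ) / (6 * α + σ) := by
  rw [div_le_div_iff₀ (by norm_num) (by positivity)]
  linarith

theorem exists_linkRegular_probit {α σ : ℝ} (hα : 0 < α) (hσ : 0 < σ) :
    ∃ m l L, LinkRegular (Link.probit.fn σ) (Set.Icc (-α) α) m l L ∧
      L / (m * l ^ 2) ≤ 96 * (√(2 * Real.pi) ^ 3 * Real.exp 3) *
        Link.probit.scaleFactor 1 1 1 α σ := by
  have hx : 0 ≤ α / σ := by positivity
  refine ⟨_, _, _, (linkRegular_cdf_gaussianReal hx).comp_div hσ (mapsTo_div_Icc hσ), ?_⟩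
  rw [gaussianPDFReal_zero_one, Link.scaleFactor, ← div_pow]
  generalize α / σ = x at hx ⊢
  generalize hs : √(2 * Real.pi) = s
  have hs0 : 0 < s := by rw [← hs]; positivity
  have hexp3 : Real.exp 3 = Real.exp (3 / 2) * Real.exp (3 / 2) := by
    rw [← Real.exp_add]; norm_num
  have hexp_sq : Real.exp (x ^ 2) = Real.exp (x ^ 2 / 2) * Real.exp (x ^ 2 / 2) := by
    rw [← Real.exp_add, add_halves]
  calc _ = 4 * (s ^ 3 * Real.exp 3) * σ * (1 + x) ^ 2 * Real.exp (x ^ 2 / 2) := by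
        rw [neg_div, Real.exp_neg, Real.exp_neg, hexp3]
        field_simp
        ring
    _ ≤ 4 * (s ^ 3 * Real.exp 3) * σ * (4 * Real.exp (x ^ 2 / 2)) * Real.exp (x ^ 2 / 2) := by
        gcongr
        exact one_add_sq_le_exp x
    _ = 96 * (s ^ 3 * Real.exp 3) * (1 * σ * (1 / 6) * Real.exp (x ^ 2)) := by
        rw [hexp_sq]; ring
    _ ≤ 96 * (s ^ 3 * Real.exp 3) *
          (1 * σ * ((α + σ) / (6 * α + σ)) * Real.exp (x ^ 2)) := by
        have hsixth := one_sixth_le_div hα hσ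
        gcongr

theorem scaleFactor_one_pos (link : Link) {α σ : ℝ} (hα : 0 < α) (hσ : 0 < σ) :
    0 < link.scaleFactor 1 1 1 α σ := by
  cases link <;> rw [Link.scaleFactor] <;> positivity

theorem scaleFactor_const (c : ℝ) (link : Link) (α σ : ℝ) :
    link.scaleFactor c c c α σ = c * link.scaleFactor 1 1 1 α σ := by
  cases link <;> simp only [Link.scaleFactor] <;> ring

theorem exists_linkRegular : ∃ κ : ℝ, 0 < κ ∧ ∀ (link : Link) (α σ : ℝ), 0 < α → 0 < σ →
    ∃ m l L, LinkRegular (link.fn σ) (Set.Icc (-α) α) m l L ∧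
      L / (m * l ^ 2) ≤ κ * link.scaleFactor 1 1 1 α σ := by
  set B := √(2 * Real.pi) ^ 3 * Real.exp 3
  have hB : 0 < B := by positivity
  refine ⟨8 + 96 * B, by positivity, fun link α σ hα hσ => ?_⟩
  have hpos := scaleFactor_one_pos link hα hσ
  cases link with
  | logistic =>
    obtain ⟨m, l, L, hreg, hratio⟩ := exists_linkRegular_logistic (α := α) hσ
    exact ⟨m, l, L, hreg, by nlinarith⟩
  | probit =>
    obtain ⟨m, l, L, hreg, hratio⟩ := exists_linkRegular_probit hα hσ
    exact ⟨m, l, L, hreg, hratio.trans (by gcongr; linarith)⟩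
  | laplacian =>
    obtain ⟨m, l, L, hreg, hratio⟩ := exists_linkRegular_laplacian (α := α) hσ
    exact ⟨m, l, L, hreg, by nlinarith⟩

end ScaleFactor

section MLE

variable {K : ℕ} {f : ℝ → ℝ} {S : Set ℝ} {m l L : ℝ}

section Model

variable {d : Fin K → ℕ} {Ω : Type*} [MeasurableSpace Ω] {μ : Measure Ω} [IsProbabilityMeasure μ]
  {Θ : RealTensor d} {Y : Ω → BinTensor d}

theorem FollowsBernoulliModel.mem_Icc (h : FollowsBernoulliModel μ f Θ Y) (i : Idx d) :
    f (Θ i) ∈ Set.Icc 0 1 :=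
  h.prob_one i ▸ ⟨measureReal_nonneg, measureReal_le_one⟩

theorem FollowsBernoulliModel.measureReal_apply_eq (h : FollowsBernoulliModel μ f Θ Y) (i : Idx d)
    (b : Bool) : μ.real {ω | Y ω i = b} = if b then f (Θ i) else 1 - f (Θ i) := by
  cases b with
  | true => exact h.prob_one i
  | false =>
    have hcompl : {ω | Y ω i = false} = {ω | Y ω i = true}ᶜ := by
      ext ω
      simp
    have hmeas : MeasurableSet {ω | Y ω i = true} :=
      h.measurable i (MeasurableSet.singleton true)
    rw [hcompl, probReal_compl_eq_one_sub hmeas, h.prob_one i]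
    rfl

theorem FollowsBernoulliModel.measureReal_eq (h : FollowsBernoulliModel μ f Θ Y)
    (y : BinTensor d) : μ.real {ω | Y ω = y} = bernoulliWeight (fun i => f (Θ i)) y := by
  have hinter : {ω | Y ω = y} = ⋂ i ∈ Finset.univ, (fun ω => Y ω i) ⁻¹' {y i} := by
    ext ω
    simp [funext_iff]
  rw [hinter, measureReal_def, h.indep.measure_inter_preimage_eq_mul Finset.univ
    (sets := fun i => {y i}) fun i _ => MeasurableSet.singleton _, ENNReal.toReal_prod]
  exact Finset.prod_congr rfl fun i _ => h.measureReal_apply_eq i (y i)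

theorem FollowsBernoulliModel.measureReal_mem_le_bernoulliMean (h : FollowsBernoulliModel μ f Θ Y)
    {A : Set (BinTensor d)} {G : BinTensor d → ℝ} (hG : ∀ y, 0 ≤ G y) (hA : ∀ y ∈ A, 1 ≤ G y) :
    μ.real {ω | Y ω ∈ A} ≤ bernoulliMean (fun i => f (Θ i)) G := by
  classical
  have hunion : {ω | Y ω ∈ A} = ⋃ y ∈ Finset.univ.filter (· ∈ A), {ω | Y ω = y} := by
    ext ω
    simp
  have hw := bernoulliWeight_nonneg h.mem_Icc
  calc μ.real {ω | Y ω ∈ A} ≤ ∑ y with y ∈ A, μ.real {ω | Y ω = y} :=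
        hunion ▸ measureReal_biUnion_finset_le _ _
    _ ≤ ∑ y with y ∈ A, bernoulliWeight (fun i => f (Θ i)) y * G y :=
        Finset.sum_le_sum fun y hy => (h.measureReal_eq y).trans_le
          (le_mul_of_one_le_right (hw y) (hA y (Finset.mem_filter.1 hy).2))
    _ ≤ bernoulliMean (fun i => f (Θ i)) G :=
        Finset.sum_le_sum_of_subset_of_nonneg (Finset.filter_subset _ _) fun y _ _ =>
          mul_nonneg (hw y) (hG y)

end Model

theorem logLikelihood_sub_logLikelihood {d : Fin K → ℕ} (f : ℝ → ℝ) (y : BinTensor d)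
    (Θ Θ' : RealTensor d) :
    logLikelihood f y Θ' - logLikelihood f y Θ =
      ∑ i, ((if y i then 1 else 0) - f (Θ i)) * (logit (f (Θ' i)) - logit (f (Θ i))) -
        ∑ i, bernoulliKL (f (Θ i)) (f (Θ' i)) := by
  rw [logLikelihood, logLikelihood, ← Finset.sum_sub_distrib, ← Finset.sum_sub_distrib]
  refine Finset.sum_congr rfl fun i _ => ?_
  unfold logit bernoulliKL
  split_ifs <;> ring

theorem LinkRegular.mul_sum_sq_le_of_logLikelihood_le {d : Fin K → ℕ} (h : LinkRegular f S m l L)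
    {Θ Θ' : RealTensor d} (hΘ : ∀ i, Θ i ∈ S) (hΘ' : ∀ i, Θ' i ∈ S) {y : BinTensor d}
    (hle : logLikelihood f y Θ ≤ logLikelihood f y Θ') :
    m * l ^ 2 / 2 * ∑ i, (Θ' i - Θ i) ^ 2 ≤
      ∑ i, ((if y i then 1 else 0) - f (Θ i)) * (logit (f (Θ' i)) - logit (f (Θ i))) := by
  have hKL : m * l ^ 2 / 2 * ∑ i, (Θ' i - Θ i) ^ 2 ≤ ∑ i, bernoulliKL (f (Θ i)) (f (Θ' i)) := by
    rw [Finset.mul_sum]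
    exact Finset.sum_le_sum fun i _ => h.mul_sub_sq_le_bernoulliKL (hΘ i) (hΘ' i)
  linarith [logLikelihood_sub_logLikelihood f y Θ Θ']

section NoiseSupremum

variable {d : Fin (K + 1) → ℕ} {R : ℕ}

theorem neg_mul_sum_sq_add_sum_mul_le {T U : RealTensor d} (hT : HasCPRankLE T R) {a b z : ℝ}
    (hb : 0 ≤ b) (hab : b ^ 2 * 4 ^ (K + 1) * R ^ K ≤ a)
    (hz : ∀ x, (∀ k, ‖x k‖ ≤ 1) → multiForm U x ≤ 2 ^ (K + 1) * z) :
    -(a * ∑ i, T i ^ 2) + ∑ i, U i * (b * T i) ≤ z ^ 2 / 4 := by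
  have hdual := sum_mul_le_of_multiForm_le hT hz
  have hlin : ∑ i, U i * (b * T i) = b * ∑ i, U i * T i := by
    simp only [Finset.mul_sum, mul_left_comm]
  have hQ : 0 ≤ ∑ i, T i ^ 2 := Finset.sum_nonneg fun i _ => sq_nonneg _
  have hsquare : (b * 2 ^ (K + 1) * √(R ^ K) * √(∑ i, T i ^ 2)) ^ 2 ≤ a * ∑ i, T i ^ 2 := by
    rw [mul_pow, mul_pow, mul_pow, Real.sq_sqrt (by positivity), Real.sq_sqrt hQ, ← pow_mul,
      mul_comm (K + 1), pow_mul]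
    norm_num only
    gcongr
  have hscaled := mul_le_mul_of_nonneg_left hdual hb
  rw [hlin]
  linarith [sq_nonneg (z / 2 - b * 2 ^ (K + 1) * √(R ^ K) * √(∑ i, T i ^ 2))]

theorem exists_norming_finset_multiForm :
    ∃ N : Finset ((k : Fin (K + 1)) → EuclideanSpace ℝ (Fin (d k))),
      N.card ≤ 5 ^ ∑ k, d k ∧ (∀ z ∈ N, ∑ i : Idx d, (∏ k, z k (i k)) ^ 2 ≤ 1) ∧
        ∀ U : RealTensor d, ∃ z ∈ N, ∀ x, (∀ k, ‖x k‖ ≤ 1) →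
          multiForm U x ≤ 2 ^ (K + 1) * multiForm U z := by
  choose N hcard hball hN using fun k => exists_norming_finset (E := EuclideanSpace ℝ (Fin (d k)))
  refine ⟨Fintype.piFinset N, ?_, fun z hz => ?_, fun U => ?_⟩
  · rw [Fintype.card_piFinset, ← Finset.prod_pow_eq_pow_sum]
    exact Finset.prod_le_prod' fun k _ => (hcard k).trans_eq (by rw [finrank_euclideanSpace_fin])
  · rw [sum_sq_prod_eq_prod_norm_sq]
    exact Finset.prod_le_one (fun _ _ => sq_nonneg _) fun k _ =>
      pow_le_one₀ (norm_nonneg _) (hball k _ (Fintype.mem_piFinset.1 hz k))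
  · obtain ⟨y, hy, -⟩ := exists_multiForm_le_of_norming hN U (x := 0) (by simp)
    obtain ⟨z, hz, hmax⟩ := (Fintype.piFinset N).exists_max_image (multiForm U) ⟨y, hy⟩
    refine ⟨z, hz, fun x hx => ?_⟩
    obtain ⟨y, hy, hle⟩ := exists_multiForm_le_of_norming hN U hx
    exact hle.trans (mul_le_mul_of_nonneg_left (hmax y hy) (by positivity))

variable {τ : Type*} [Nonempty τ]

theorem rademacherMean_exp_iSup_penalized_le {T : τ → RealTensor d}
    (hT : ∀ t, HasCPRankLE (T t) R) {a b : ℝ} (hb : 0 ≤ b)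
    (hab : b ^ 2 * 4 ^ (K + 1) * R ^ K ≤ a) :
    rademacherMean (fun ε : RealTensor d =>
        Real.exp (⨆ t, (-(a * ∑ i, T t i ^ 2) + ∑ i, ε i * (b * T t i)))) ≤
      5 ^ (∑ k, d k) * √2 := by
  obtain ⟨N, hcard, hN, hnorming⟩ := exists_norming_finset_multiForm (d := d)
  have hsup (ε : RealTensor d) :
      Real.exp (⨆ t, (-(a * ∑ i, T t i ^ 2) + ∑ i, ε i * (b * T t i))) ≤
        ∑ z ∈ N, Real.exp (multiForm ε z ^ 2 / 4) := by
    obtain ⟨z, hz, hle⟩ := hnorming ε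
    have hle_sq := ciSup_le fun t => neg_mul_sum_sq_add_sum_mul_le (hT t) hb hab hle
    exact (Real.exp_le_exp.2 hle_sq).trans
      (Finset.single_le_sum (f := fun z => Real.exp (multiForm ε z ^ 2 / 4))
        (fun z _ => (Real.exp_pos _).le) hz)
  calc _ ≤ ∑ z ∈ N, rademacherMean fun ε : RealTensor d => Real.exp (multiForm ε z ^ 2 / 4) :=
        (rademacherMean_mono hsup).trans_eq (rademacherMean_sum _ _)
    _ ≤ N.card • √2 := Finset.sum_le_card_nsmul _ _ _ fun z hz => rademacherMean_exp_sq_le (hN z hz)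
    _ ≤ _ := by
        rw [nsmul_eq_mul]
        gcongr
        exact_mod_cast hcard

theorem LinkRegular.bernoulliMean_exp_iSup_penalized_le [Finite τ] (h : LinkRegular f S m l L)
    {Θ : RealTensor d} (hΘ : ∀ i, Θ i ∈ S) {T : τ → RealTensor d} (hT : ∀ t i, T t i ∈ S)
    (hrank : ∀ t, HasCPRankLE (T t - Θ) R) {a r : ℝ} (hr : 0 ≤ r)
    (har : (r * L) ^ 2 * 4 ^ (K + 1) * R ^ K ≤ a) :
    bernoulliMean (fun i => f (Θ i)) (fun y => Real.exp (⨆ t, (-(a * ∑ i, (T t - Θ) i ^ 2) +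
        ∑ i, ((if y i then 1 else 0) - f (Θ i)) *
          (r * (logit (f (T t i)) - logit (f (Θ i))))))) ≤ 5 ^ (∑ k, d k) * √2 := by
  have hL := h.L_pos
  have hLip (s) (hs : s ∈ S) (t) (ht : t ∈ S) :
      r * |logit (f s) - logit (f t)| ≤ r * L * |s - t| :=
    (mul_le_mul_of_nonneg_left (h.abs_logit_sub_le s hs t ht) hr).trans_eq (mul_assoc _ _ _).symm
  have habs (x y : ℝ) : |r * x| = r * |x| ∧ |r * L * y| = r * L * |y| :=
    ⟨by rw [abs_mul, abs_of_nonneg hr], by rw [abs_mul, abs_of_nonneg (by positivity)]⟩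
  refine (bernoulliMean_iSup_le_rademacherMean_iSup convexOn_exp Real.exp_monotone
    (fun i => Set.Ioo_subset_Icc_self (h.mem_Ioo _ (hΘ i))) _ _
    (fun i t => r * L * (T t - Θ) i) (fun i t s => ?_) fun i t => ?_).trans
      (rademacherMean_exp_iSup_penalized_le hrank (by positivity) har)
  · rw [← mul_sub, ← mul_sub, (habs _ 0).1, (habs 0 _).2, sub_sub_sub_cancel_right, Pi.sub_apply,
      Pi.sub_apply, sub_sub_sub_cancel_right]
    exact hLip _ (hT t i) _ (hT s i)
  · rw [(habs _ 0).1, (habs 0 _).2, Pi.sub_apply]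
    exact hLip _ (hT t i) _ (hΘ i)

end NoiseSupremum

theorem frobeniusNorm_sq {d : Fin K → ℕ} (A : RealTensor d) : frobeniusNorm A ^ 2 = ∑ i, A i ^ 2 :=
  Real.sq_sqrt (Finset.sum_nonneg fun i _ => sq_nonneg (A i))

theorem five_pow_mul_sqrt_two_le {n : ℕ} (hn : n ≠ 0) : (5 : ℝ) ^ n * √2 ≤ Real.exp (3 * n) := by
  have he : (2.7 : ℝ) ≤ Real.exp 1 := by linarith [Real.exp_one_gt_d9]
  have hsqrt : √2 ≤ Real.exp 1 ^ n := by
    refine le_trans ?_ (le_self_pow₀ (by linarith) hn)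
    rw [Real.sqrt_le_left (Real.exp_pos _).le]
    nlinarith
  have hfive : (5 : ℝ) ≤ Real.exp 1 ^ 2 := by nlinarith
  calc (5 : ℝ) ^ n * √2 ≤ (Real.exp 1 ^ 2) ^ n * Real.exp 1 ^ n := by gcongr
    _ = Real.exp (3 * n) := by
      rw [← pow_mul, ← pow_add, Real.exp_one_pow]
      push_cast
      ring_nf

section Tail

variable {d : Fin (K + 1) → ℕ} {R : ℕ} {Θ : RealTensor d} {Θhat : BinTensor d → RealTensor d}
  {Ω : Type*} [MeasurableSpace Ω] {μ : Measure Ω} [IsProbabilityMeasure μ] {Y : Ω → BinTensor d}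

-- The basic inequality gains `r m l² / 2 = 2 a` times the squared error: one half is the penalty
-- that keeps the exponential moment of the supremum bounded, the other half gives the tail.
theorem LinkRegular.measureReal_lt_frobeniusNorm_le_of_scale (h : LinkRegular f S m l L)
    (hΘ : ∀ i, Θ i ∈ S) (hΘhat : ∀ y i, Θhat y i ∈ S) (hrank : ∀ y, HasCPRankLE (Θhat y - Θ) R)
    (hlik : ∀ y, logLikelihood f y Θ ≤ logLikelihood f y (Θhat y))
    (hY : FollowsBernoulliModel μ f Θ Y) {a r δ : ℝ} (hr : 0 ≤ r) (hδ : 0 ≤ δ)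
    (har : (r * L) ^ 2 * 4 ^ (K + 1) * R ^ K ≤ a) (ha : 2 * a = r * (m * l ^ 2 / 2)) :
    μ.real {ω | δ < frobeniusNorm (Θhat (Y ω) - Θ)} ≤
      Real.exp (-(a * δ ^ 2)) * (5 ^ (∑ k, d k) * √2) := by
  have ha0 : 0 ≤ a := le_trans (by positivity) har
  let G (y t : BinTensor d) : ℝ := -(a * ∑ i, (Θhat t - Θ) i ^ 2) +
    ∑ i, ((if y i then 1 else 0) - f (Θ i)) * (r * (logit (f (Θhat t i)) - logit (f (Θ i))))
  have hG (y) : a * frobeniusNorm (Θhat y - Θ) ^ 2 ≤ ⨆ t, G y t := by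
    refine le_trans ?_ (Finite.le_ciSup (G y) y)
    have hbasic := mul_le_mul_of_nonneg_left
      (h.mul_sum_sq_le_of_logLikelihood_le hΘ (hΘhat y) (hlik y)) hr
    have hlin : ∑ i, ((if y i then 1 else 0) - f (Θ i)) *
          (r * (logit (f (Θhat y i)) - logit (f (Θ i)))) =
        r * ∑ i, ((if y i then 1 else 0) - f (Θ i)) * (logit (f (Θhat y i)) - logit (f (Θ i))) := by
      simp only [Finset.mul_sum, mul_left_comm]
    rw [← mul_assoc, ← ha] at hbasic
    rw [frobeniusNorm_sq]
    simp only [G, hlin, Pi.sub_apply]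
    linarith
  refine (hY.measureReal_mem_le_bernoulliMean (A := {y | δ < frobeniusNorm (Θhat y - Θ)})
    (G := fun y => Real.exp (-(a * δ ^ 2)) * Real.exp (⨆ t, G y t))
    (fun y => by positivity) fun y (hy : δ < _) => ?_).trans ?_
  · rw [← Real.exp_add, Real.one_le_exp_iff]
    have : a * δ ^ 2 ≤ a * frobeniusNorm (Θhat y - Θ) ^ 2 := by gcongr
    linarith [hG y]
  · rw [bernoulliMean_const_mul]
    exact mul_le_mul_of_nonneg_left
      (h.bernoulliMean_exp_iSup_penalized_le hΘ hΘhat hrank hr har) (Real.exp_pos _).le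

theorem LinkRegular.measureReal_lt_frobeniusNorm_le (h : LinkRegular f S m l L)
    (hΘ : ∀ i, Θ i ∈ S) (hΘhat : ∀ y i, Θhat y i ∈ S) (hrank : ∀ y, HasCPRankLE (Θhat y - Θ) R)
    (hlik : ∀ y, logLikelihood f y Θ ≤ logLikelihood f y (Θhat y))
    (hY : FollowsBernoulliModel μ f Θ Y) (hR : 0 < R) {t : ℝ} (ht : 0 ≤ t) :
    μ.real {ω | L / (m * l ^ 2) * t < frobeniusNorm (Θhat (Y ω) - Θ)} ≤
      Real.exp (-(t ^ 2 / (4 ^ (K + 3) * R ^ K))) * (5 ^ (∑ k, d k) * √2) := by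
  have hm := h.m_pos
  have hl := h.l_pos
  have hL := h.L_pos
  set a := (m * l ^ 2) ^ 2 / (4 ^ (K + 3) * L ^ 2 * R ^ K) with ha
  have hexponent : a * (L / (m * l ^ 2) * t) ^ 2 = t ^ 2 / (4 ^ (K + 3) * R ^ K) := by
    rw [ha]
    field_simp
  rw [← hexponent]
  refine h.measureReal_lt_frobeniusNorm_le_of_scale (r := 4 * a / (m * l ^ 2)) hΘ hΘhat hrank hlik
    hY (by positivity) (by positivity) (le_of_eq ?_) ?_
  · rw [ha]
    field_simp
    ring
  · field_simp
    ring

theorem LinkRegular.le_measureReal_frobeniusNorm_le (h : LinkRegular f S m l L)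
    (hΘ : ∀ i, Θ i ∈ S) (hΘhat : ∀ y i, Θhat y i ∈ S) (hrank : ∀ y, HasCPRankLE (Θhat y - Θ) R)
    (hlik : ∀ y, logLikelihood f y Θ ≤ logLikelihood f y (Θhat y))
    (hY : FollowsBernoulliModel μ f Θ Y) (hR : 0 < R) {c : ℝ} (hc : 0 ≤ c) :
    1 - Real.exp (-(c * ∑ k, (d k : ℝ))) ≤
      μ.real {ω | frobeniusNorm (Θhat (Y ω) - Θ) ≤
        L / (m * l ^ 2) * √(4 ^ (K + 3) * R ^ K * ((c + 3) * ∑ k, (d k : ℝ)))} := by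
  rw [← Nat.cast_sum]
  rcases eq_or_ne (∑ k, d k) 0 with hzero | hne
  · simp [hzero]
  set t := √(4 ^ (K + 3) * R ^ K * ((c + 3) * (∑ k, d k : ℕ)))
  have hexponent : t ^ 2 / (4 ^ (K + 3) * R ^ K) = (c + 3) * (∑ k, d k : ℕ) := by
    rw [Real.sq_sqrt (by positivity), mul_div_cancel_left₀ _ (by positivity)]
  have htail : μ.real {ω | L / (m * l ^ 2) * t < frobeniusNorm (Θhat (Y ω) - Θ)} ≤
      Real.exp (-(c * (∑ k, d k : ℕ))) := by
    refine (h.measureReal_lt_frobeniusNorm_le hΘ hΘhat hrank hlik hY hR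
      (Real.sqrt_nonneg _)).trans ?_
    refine (mul_le_mul_of_nonneg_left (five_pow_mul_sqrt_two_le hne)
      (Real.exp_pos _).le).trans_eq ?_
    rw [hexponent, ← Real.exp_add]
    ring_nf
  have hmeas : MeasurableSet {ω | L / (m * l ^ 2) * t < frobeniusNorm (Θhat (Y ω) - Θ)} :=
    (measurable_pi_lambda Y hY.measurable)
      (Set.toFinite {y | L / (m * l ^ 2) * t < frobeniusNorm (Θhat y - Θ)}).measurableSet
  have hcompl := probReal_compl_eq_one_sub (μ := μ) hmeas
  simp only [Set.compl_ofPred, not_lt] at hcompl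
  linarith

end Tail

end MLE

theorem loss_le_two_mul {K : ℕ} {d : Fin K → ℕ} {α : ℝ} (hα : 0 ≤ α) {Θ Θ' : RealTensor d}
    (hΘ : ∀ i, |Θ i| ≤ α) (hΘ' : ∀ i, |Θ' i| ≤ α) : loss Θ Θ' ≤ 2 * α := by
  have hentry (i) : (Θ - Θ') i ^ 2 ≤ (2 * α) ^ 2 :=
    sq_le_sq' (by rw [Pi.sub_apply]; linarith [abs_le.1 (hΘ i), abs_le.1 (hΘ' i)])
      (by rw [Pi.sub_apply]; linarith [abs_le.1 (hΘ i), abs_le.1 (hΘ' i)])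
  have hnorm : frobeniusNorm (Θ - Θ') ≤ √(∏ k, (d k : ℝ)) * (2 * α) := by
    rw [frobeniusNorm, ← Real.sqrt_sq (show 0 ≤ 2 * α by positivity),
      ← Real.sqrt_mul (by positivity)]
    refine Real.sqrt_le_sqrt ((Finset.sum_le_sum fun i _ => hentry i).trans_eq ?_)
    simp [Fintype.card_pi]
  calc loss Θ Θ' ≤ 1 / √(∏ k, (d k : ℝ)) * (√(∏ k, (d k : ℝ)) * (2 * α)) :=
        mul_le_mul_of_nonneg_left hnorm (by positivity)
    _ = √(∏ k, (d k : ℝ)) / √(∏ k, (d k : ℝ)) * (2 * α) := by ring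
    _ ≤ 2 * α := mul_le_of_le_one_left (by positivity) (div_self_le_one _)

theorem loss_le_mul_sqrt_div {K : ℕ} {d : Fin K → ℕ} {Θ Θ' : RealTensor d} {b V : ℝ}
    (hV : 0 ≤ V) (h : frobeniusNorm (Θ - Θ') ≤ b * √V) :
    loss Θ Θ' ≤ b * √(V / ∏ k, (d k : ℝ)) := by
  rw [loss, Real.sqrt_div hV, one_div_mul_eq_div, ← mul_div_assoc]
  gcongr

end BinaryTensor

end

theorem corollary1_general {K : ℕ} (hK : 1 ≤ K) {c : ℝ} (hc : 0 ≤ c) :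
    ∃ C₁ C₂ C₃ : ℝ, 0 < C₁ ∧ 0 < C₂ ∧ 0 < C₃ ∧
      ∀ (link : BinaryTensor.Link) (d : Fin K → ℕ) (R : ℕ) (α σ : ℝ)
        (Θtrue : BinaryTensor.RealTensor d)
        (Θhat : BinaryTensor.BinTensor d → BinaryTensor.RealTensor d)
        (Ω : Type*) [MeasurableSpace Ω] (μ : MeasureTheory.Measure Ω)
        [MeasureTheory.IsProbabilityMeasure μ] (Y : Ω → BinaryTensor.BinTensor d),
        1 ≤ R → 0 < α → 0 < σ →
        BinaryTensor.HasCPRankLE Θtrue R → (∀ i, |Θtrue i| ≤ α) →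
        (∀ y, BinaryTensor.HasCPRankLE (Θhat y) R) → (∀ y i, |Θhat y i| ≤ α) →
        BinaryTensor.FollowsBernoulliModel μ (link.fn σ) Θtrue Y →
        (∀ y, BinaryTensor.logLikelihood (link.fn σ) y Θtrue ≤
          BinaryTensor.logLikelihood (link.fn σ) y (Θhat y)) →
        1 - Real.exp (-(c * ∑ k, (d k : ℝ))) ≤
          μ.real {ω | BinaryTensor.loss (Θhat (Y ω)) Θtrue ≤
            min (2 * α)
              (link.scaleFactor C₁ C₂ C₃ α σ *
                √((R : ℝ) ^ (K - 1) * (∑ k, (d k : ℝ)) / ∏ k, (d k : ℝ)))} := by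
  obtain ⟨K, rfl⟩ := Nat.exists_eq_add_of_le' hK
  obtain ⟨κ, hκ, hlink⟩ := BinaryTensor.exists_linkRegular
  set A := √(4 ^ (K + 3) * 2 ^ K * (c + 3))
  have : 0 < A := Real.sqrt_pos.2 (by positivity)
  refine ⟨κ * A, κ * A, κ * A, by positivity, by positivity, by positivity, ?_⟩
  intro link d R α σ Θ Θhat Ω _ μ _ Y hR hα hσ hrank hΘ hrank' hΘhat hY hlik
  obtain ⟨m, l, L, hreg, hratio⟩ := hlink link α σ hα hσ
  refine (hreg.le_measureReal_frobeniusNorm_le (fun i => abs_le.1 (hΘ i))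
    (fun y i => abs_le.1 (hΘhat y i)) (fun y => (hrank' y).sub hrank) hlik hY (by lia)
    hc).trans (MeasureTheory.measureReal_mono fun ω hω => le_min
      (BinaryTensor.loss_le_two_mul hα.le (hΘhat _) hΘ)
      (BinaryTensor.loss_le_mul_sqrt_div (by positivity) (le_trans hω ?_)))
  calc _ = L / (m * l ^ 2) * (A * √(R ^ K * ∑ k, (d k : ℝ))) := by
        rw [← Real.sqrt_mul (by positivity)]
        push_cast
        ring_nf
    _ ≤ κ * link.scaleFactor 1 1 1 α σ * (A * √(R ^ K * ∑ k, (d k : ℝ))) := by gcongr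
    _ = _ := by
        rw [BinaryTensor.scaleFactor_const (κ * A), Nat.add_sub_cancel]
        ring

theorem corollary1 :
    ∃ C' : ℝ, 0 < C' ∧
      ∀ K : ℕ, 1 ≤ K →
        ∃ C₁ C₂ C₃ : ℝ, 0 < C₁ ∧ 0 < C₂ ∧ 0 < C₃ ∧
          ∀ (link : BinaryTensor.Link) (d : Fin K → ℕ) (R : ℕ) (α σ : ℝ)
            (D : Set (BinaryTensor.RealTensor d)) (Θtrue : BinaryTensor.RealTensor d)
            (Θhat : BinaryTensor.BinTensor d → BinaryTensor.RealTensor d)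
            (Ω : Type*) [MeasurableSpace Ω] (μ : MeasureTheory.Measure Ω)
            [MeasureTheory.IsProbabilityMeasure μ] (Y : Ω → BinaryTensor.BinTensor d),
            1 ≤ R → 0 < α → 0 < σ →
            D ⊆ BinaryTensor.signalSet d R α → IsCompact D → Θtrue ∈ D →
            BinaryTensor.FollowsBernoulliModel μ (link.fn σ) Θtrue Y →
            (∀ y, BinaryTensor.IsConstrainedMLE (link.fn σ) D y (Θhat y)) →
            1 - Real.exp (-(C' * Real.log K * ∑ k, (d k : ℝ))) ≤
              μ.real {ω | BinaryTensor.loss (Θhat (Y ω)) Θtrue ≤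
                min (2 * α)
                  (link.scaleFactor C₁ C₂ C₃ α σ *
                    Real.sqrt ((R : ℝ) ^ (K - 1) * (∑ k, (d k : ℝ)) / ∏ k, (d k : ℝ)))} := by
  refine ⟨1, one_pos, fun K hK => ?_⟩
  obtain ⟨C₁, C₂, C₃, h₁, h₂, h₃, h⟩ := corollary1_general hK (Real.log_natCast_nonneg K)
  refine ⟨C₁, C₂, C₃, h₁, h₂, h₃, ?_⟩
  intro link d R α σ D Θ Θhat Ω _ μ _ Y hR hα hσ hD _ hΘ hY hmle
  rw [one_mul]
  exact h link d R α σ Θ Θhat Ω μ Y hR hα hσ (hD hΘ).1.1.hasCPRankLE (hD hΘ).2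
    (fun y => (hD (hmle y).1).1.1.hasCPRankLE) (fun y => (hD (hmle y).1).2) hY
    fun y => (hmle y).2 hΘ
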